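/- **Setting.** Finitely many agents are partitioned into $S$ sending sub-networks $s=1,\dots,S$ and $R$ receiving sub-networks $r=S+1,\dots,S+R$. Agent $k$ scales the data arriving from agent $\ell$ with a weight $a_{\ell k}\ge 0$, and $\sum_\ell a_{\ell k}=1$ for every $k$. The network is weakly connected: an agent of a sending sub-network gives zero weight to all agents outside its own sub-network; an agent of a receiving sub-network gives zero weight to the agents of all later receiving sub-networks (the matrix $A=[a_{\ell k}]$ is block upper triangular); each sending sub-network is strongly connected (inside it there are paths of positive weight from any agent to any other, and $a_{kk}>0$ for at least one of its agents); each receiving sub-network is connected (paths of positive weight inside it from any agent to any other, no self-loop required), and at least one of its agents gives a positive weight to an agent outside it. Let $\Theta$ be a finite set of states and, for each agent $k$, let $Z_k$ be a finite signal space and $L_k(\cdot\mid\theta)$, $\theta\in\Theta$, probability mass functions on $Z_k$. Sub-network $s$ (resp. $r$) has true state $\theta_s^\circ\in\Theta$ (resp. $\theta_r^\circ\in\Theta$). At each time $i\ge1$ agent $k$ observes a random signal $\boldsymbol\xi_{k,i}\in Z_k$ with distribution $L_k(\cdot\mid\theta^\circ)$, where $\theta^\circ$ is the true state of the sub-network of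 $k$; the signal profiles $(\boldsymbol\xi_{k,i})_k$, $i\ge1$, are independent over time. Starting from probability mass functions $\mu_{k,0}$ on $\Theta$, the beliefs follow the diffusion strategy $$\boldsymbol\psi_{k,i}(\theta)=\frac{\boldsymbol\mu_{k,i-1}(\theta)L_k(\boldsymbol\xi_{k,i}\mid\theta)}{\sum_{\theta'\in\Theta}\boldsymbol\mu_{k,i-1}(\theta')L_k(\boldsymbol\xi_{k,i}\mid\theta')},\qquad \boldsymbol\mu_{k,i}(\theta)=\sum_{\ell}a_{\ell k}\boldsymbol\psi_{\ell,i}(\theta)$$ (a quotient with denominator $0$ is read as $0$), and the forecast of agent $k$ is $\boldsymbol m_{k,i}(\zeta)=\sum_{\theta\in\Theta}\boldsymbol\mu_{k,i}(\theta)L_k(\zeta\mid\theta)$, $\zeta\in Z_k$. For an agent $k$ of a sub-network with true state $\theta^\circ$, let $\Theta_k=\{\theta\in\Theta: L_k(\zeta\mid\theta)=L_k(\zeta\mid\theta^\circ)\ \forall \zeta\in Z_k\}$ be its set of indistinguishable states. Assume that in each sending sub-network $s$: (i) some agent $k$ has $\mu_{k,0}(\theta_s^\circ)>0$; (ii) every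 agent $k$ has a prevailing signal $\zeta_k^\circ\in Z_k$, i.e. $L_k(\zeta_k^\circ\mid\theta_s^\circ)>L_k(\zeta_k^\circ\mid\theta)$ for all $\theta\in\Theta\setminus\Theta_k$; (iii) $\bigcap_{k\in s}\Theta_k=\{\theta_s^\circ\}$. **Lemma (Correct Forecasting).** Suppose that $\theta_s^\circ\in\Theta_k$ for every sending sub-network $s$ and every agent $k$ of a receiving sub-network. Then for every receiving sub-network $r$, every agent $k$ of $r$ and every $\zeta_k\in Z_k$, almost surely $$\lim_{i\to\infty}\boldsymbol m_{k,i}(\zeta_k)=L_k(\zeta_k\mid\theta_r^\circ).$$ -/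

import Mathlib

open Filter Topology MeasureTheory ProbabilityTheory
open scoped BigOperators

namespace SocialLearning

noncomputable section

/-! ### Weakly connected networks

Agents form a finite type `V`; `net : V → Fin S ⊕ Fin R` assigns to every agent its sub-network,
`Sum.inl s` for sending and `Sum.inr r` for receiving sub-networks. The entry `a ℓ k` of the
combination matrix is the weight with which agent `k` scales the data arriving from agent `ℓ`. -/

/-- Inside the set `I` of agents there is a path with positive weights from any agent to any
other agent. -/
def IsConnectedOn {V : Type*} (a : Matrix V V ℝ) (I : Set V) : Prop :=
  ∀ ℓ ∈ I, ∀ k ∈ I, Relation.ReflTransGen (fun x y => x ∈ I ∧ y ∈ I ∧ 0 < a x y) ℓ k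

/-- Strongly connected: connected, with at least one self-loop. -/
def IsStronglyConnectedOn {V : Type*} (a : Matrix V V ℝ) (I : Set V) : Prop :=
  IsConnectedOn a I ∧ ∃ k ∈ I, 0 < a k k

/-- A weakly connected network with sending sub-networks indexed by `Fin S` and receiving
sub-networks indexed by `Fin R`. -/
structure IsWeakNetwork {V : Type*} [Fintype V] {S R : ℕ}
    (net : V → Fin S ⊕ Fin R) (a : Matrix V V ℝ) : Prop where
  /-- the weights are non-negative -/
  nonneg : ∀ ℓ k, 0 ≤ a ℓ k
  /-- every agent scales the incoming data in a convex manner (`a` is left-stochastic) -/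
  sum_eq_one : ∀ k, ∑ ℓ, a ℓ k = 1
  /-- a sending sub-network receives nothing from the other sub-networks -/
  sending_closed : ∀ ℓ k s, net k = Sum.inl s → net ℓ ≠ Sum.inl s → a ℓ k = 0
  /-- the receiving sub-networks are ordered so that their weights are block upper triangular -/
  receiving_triangular : ∀ ℓ k r r', net ℓ = Sum.inr r' → net k = Sum.inr r → r < r' → a ℓ k = 0
  /-- every sending sub-network is strongly connected -/
  sending_connected : ∀ s : Fin S, IsStronglyConnectedOn a {k | net k = Sum.inl s}
  /-- every receiving sub-network is connected; no self-loop is required -/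
  receiving_connected : ∀ r : Fin R, IsConnectedOn a {k | net k = Sum.inr r}
  /-- every receiving sub-network has a link arriving from another sub-network -/
  receiving_fed : ∀ r : Fin R, ∃ ℓ k, net ℓ ≠ Sum.inr r ∧ net k = Sum.inr r ∧ 0 < a ℓ k

/-! ### Likelihoods and signals

`L k ζ θ` is the likelihood that agent `k` gives to the signal `ζ` under the state `θ`. -/

/-- `p` is a probability mass function on a finite type. -/
def IsPmf {α : Type*} [Fintype α] (p : α → ℝ) : Prop :=
  (∀ x, 0 ≤ p x) ∧ ∑ x, p x = 1

/-- The set of states that agent `k` cannot distinguish from the state `θ₀`. -/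
def indistinguishable {V Θ : Type*} {Z : V → Type*} (L : ∀ k, Z k → Θ → ℝ) (θ₀ : Θ) (k : V) :
    Set Θ :=
  {θ | ∀ ζ : Z k, L k ζ θ = L k ζ θ₀}

/-- `ζ` is a prevailing signal of agent `k` when the true state is `θ₀`: it is more likely under
`θ₀` than under any state that the agent can distinguish from `θ₀`. -/
def IsPrevailing {V Θ : Type*} {Z : V → Type*} (L : ∀ k, Z k → Θ → ℝ) (θ₀ : Θ) (k : V)
    (ζ : Z k) : Prop :=
  ∀ θ ∉ indistinguishable L θ₀ k, L k ζ θ < L k ζ θ₀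

/-- The true state of every agent, given those of the sending and the receiving sub-networks. -/
def trueState {V Θ : Type*} {S R : ℕ} (net : V → Fin S ⊕ Fin R) (θS : Fin S → Θ)
    (θR : Fin R → Θ) (k : V) : Θ :=
  Sum.elim θS θR (net k)

/-- `ξ i ω k` is the signal that agent `k` observes at time `i ≥ 1`. At every time it is
distributed according to the likelihood of agent `k` under its true state `θ₀ k`, and the signal
profiles of the network at different times are independent. Nothing is assumed about the joint law
of the signals of different agents at the same time. -/
structure IsSignalProcess {V Θ Ω : Type*} {Z : V → Type*} [∀ k, MeasurableSpace (Z k)]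
    [MeasurableSpace Ω] (P : Measure Ω) (L : ∀ k, Z k → Θ → ℝ) (θ₀ : V → Θ)
    (ξ : ℕ → Ω → ∀ k, Z k) : Prop where
  measurable : ∀ i, 1 ≤ i → Measurable (ξ i)
  law : ∀ i, 1 ≤ i → ∀ k (ζ : Z k), P.real {ω | ξ i ω k = ζ} = L k ζ (θ₀ k)
  indep : iIndepFun (fun i : ℕ => ξ (i + 1)) P

/-! ### Diffusion social learning -/

/-- The Bayesian update of the beliefs `μ` after the signals `z`; when the denominator vanishes
the value is `0`. -/
def bayesUpdate {V Θ : Type*} {Z : V → Type*} [Fintype Θ] (L : ∀ k, Z k → Θ → ℝ)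
    (μ : V → Θ → ℝ) (z : ∀ k, Z k) (k : V) (θ : Θ) : ℝ :=
  μ k θ * L k (z k) θ / ∑ θ', μ k θ' * L k (z k) θ'

/-- The belief that agent `k` assigns to `θ` at time `i`, along the signal path `x`. -/
def belief {V Θ : Type*} {Z : V → Type*} [Fintype V] [Fintype Θ] (a : Matrix V V ℝ)
    (L : ∀ k, Z k → Θ → ℝ) (μ₀ : V → Θ → ℝ) (x : ℕ → ∀ k, Z k) : ℕ → V → Θ → ℝ
  | 0 => μ₀
  | i + 1 => fun k θ => ∑ ℓ, a ℓ k * bayesUpdate L (belief a L μ₀ x i) (x (i + 1)) ℓ θ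

/-- The forecast of agent `k` at time `i` for the probability of the signal `ζ`. -/
def forecast {V Θ : Type*} {Z : V → Type*} [Fintype V] [Fintype Θ] (a : Matrix V V ℝ)
    (L : ∀ k, Z k → Θ → ℝ) (μ₀ : V → Θ → ℝ) (x : ℕ → ∀ k, Z k) (i : ℕ) (k : V) (ζ : Z k) : ℝ :=
  ∑ θ, belief a L μ₀ x i k θ * L k ζ θ

end

end SocialLearning

open SocialLearning

namespace SocialLearning

noncomputable section

/-! ### Bayesian updates of a single agent -/

/-- A non-negative function of total mass at most one. -/
def IsSubPmf {α : Type*} [Fintype α] (p : α → ℝ) : Prop :=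
  (∀ x, 0 ≤ p x) ∧ ∑ x, p x ≤ 1

/-- The predictive probability of the signal `ζ` under the belief `p`. -/
def predictive {Θ Z : Type*} [Fintype Θ] (l : Z → Θ → ℝ) (p : Θ → ℝ) (ζ : Z) : ℝ :=
  ∑ θ, p θ * l ζ θ

/-- The Bayesian update of the belief `p` after the signal `ζ`. -/
def posterior {Θ Z : Type*} [Fintype Θ] (l : Z → Θ → ℝ) (p : Θ → ℝ) (ζ : Z) (θ : Θ) : ℝ :=
  p θ * l ζ θ / predictive l p ζ

/-- The mass that the belief `p` does not put on the set `T`. -/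
def residual {Θ : Type*} (T : Finset Θ) (p : Θ → ℝ) : ℝ :=
  1 - ∑ θ ∈ T, p θ

/-- A convex potential that vanishes exactly at full belief. -/
def surprise (x : ℝ) : ℝ := (√x)⁻¹ - 1

section Single

variable {Θ Z : Type*} [Fintype Θ] [Fintype Z] {l : Z → Θ → ℝ} {p : Θ → ℝ}

lemma IsPmf.isSubPmf {α : Type*} [Fintype α] {p : α → ℝ} (h : IsPmf p) : IsSubPmf p :=
  ⟨h.1, h.2.le⟩

lemma IsSubPmf.le_one {α : Type*} [Fintype α] {p : α → ℝ} (h : IsSubPmf p) (x : α) : p x ≤ 1 :=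
  (Finset.single_le_sum (fun y _ => h.1 y) (Finset.mem_univ x)).trans h.2

lemma IsSubPmf.sum_le_one {α : Type*} [Fintype α] {p : α → ℝ} (h : IsSubPmf p) (T : Finset α) :
    ∑ x ∈ T, p x ≤ 1 :=
  (Finset.sum_le_sum_of_subset_of_nonneg (Finset.subset_univ T) (fun y _ _ => h.1 y)).trans h.2

lemma residual_nonneg (hp : IsSubPmf p) (T : Finset Θ) : 0 ≤ residual T p := by
  have := hp.sum_le_one T
  unfold residual
  linarith

lemma residual_le_one (hp : IsSubPmf p) (T : Finset Θ) : residual T p ≤ 1 := by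
  have : 0 ≤ ∑ x ∈ T, p x := Finset.sum_nonneg fun x _ => hp.1 x
  unfold residual
  linarith

lemma predictive_nonneg (hl : ∀ θ, IsPmf fun ζ => l ζ θ) (hp : IsSubPmf p) (ζ : Z) :
    0 ≤ predictive l p ζ :=
  Finset.sum_nonneg fun θ _ => mul_nonneg (hp.1 θ) ((hl θ).1 ζ)

lemma sum_predictive_le_one (hl : ∀ θ, IsPmf fun ζ => l ζ θ) (hp : IsSubPmf p) :
    ∑ ζ, predictive l p ζ ≤ 1 := by
  unfold predictive
  rw [Finset.sum_comm]
  calc ∑ θ, ∑ ζ, p θ * l ζ θ = ∑ θ, p θ :=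
        Finset.sum_congr rfl fun θ _ => by rw [← Finset.mul_sum, (hl θ).2, mul_one]
    _ ≤ 1 := hp.2

lemma le_predictive (hl : ∀ θ, IsPmf fun ζ => l ζ θ) (hp : IsSubPmf p) (T : Finset Θ) (ζ : Z) :
    ∑ θ ∈ T, p θ * l ζ θ ≤ predictive l p ζ :=
  Finset.sum_le_sum_of_subset_of_nonneg (Finset.subset_univ T)
    fun θ _ _ => mul_nonneg (hp.1 θ) ((hl θ).1 ζ)

/-- Outside `T` the likelihoods are at most one. -/
lemma predictive_le (hl : ∀ θ, IsPmf fun ζ => l ζ θ) (hp : IsSubPmf p) (T : Finset Θ) (ζ : Z) :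
    predictive l p ζ ≤ ∑ θ ∈ T, p θ * l ζ θ + residual T p := by
  classical
  unfold predictive residual
  rw [← Finset.sum_add_sum_compl T]
  have h1 : ∑ θ ∈ Tᶜ, p θ * l ζ θ ≤ ∑ θ ∈ Tᶜ, p θ :=
    Finset.sum_le_sum fun θ _ =>
      mul_le_of_le_one_right (hp.1 θ) ((hl θ).isSubPmf.le_one ζ)
  have h2 := hp.2
  rw [← Finset.sum_add_sum_compl T] at h2
  linarith

lemma predictive_le_one (hl : ∀ θ, IsPmf fun ζ => l ζ θ) (hp : IsSubPmf p) (ζ : Z) :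
    predictive l p ζ ≤ 1 := by
  simpa [residual] using predictive_le hl hp ∅ ζ

lemma isSubPmf_posterior (hl : ∀ θ, IsPmf fun ζ => l ζ θ) (hp : IsSubPmf p) (ζ : Z) :
    IsSubPmf (posterior l p ζ) := by
  refine ⟨fun θ => div_nonneg (mul_nonneg (hp.1 θ) ((hl θ).1 ζ)) (predictive_nonneg hl hp ζ), ?_⟩
  unfold posterior
  rw [← Finset.sum_div]
  exact div_self_le_one _

lemma isPmf_posterior (hl : ∀ θ, IsPmf fun ζ => l ζ θ) (hp : IsSubPmf p) {ζ : Z}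
    (h : 0 < predictive l p ζ) : IsPmf (posterior l p ζ) := by
  refine ⟨(isSubPmf_posterior hl hp ζ).1, ?_⟩
  unfold posterior
  rw [← Finset.sum_div]
  exact div_self h.ne'

lemma predictive_pos (hl : ∀ θ, IsPmf fun ζ => l ζ θ) (hp : IsSubPmf p) {ζ : Z} {θ : Θ}
    (h : 0 < p θ) (h' : 0 < l ζ θ) : 0 < predictive l p ζ := by
  have := le_predictive hl hp {θ} ζ
  rw [Finset.sum_singleton] at this
  exact (mul_pos h h').trans_le this

lemma posterior_pos (hl : ∀ θ, IsPmf fun ζ => l ζ θ) (hp : IsSubPmf p) {ζ : Z} {θ : Θ}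
    (h : 0 < p θ) (h' : 0 < l ζ θ) : 0 < posterior l p ζ θ :=
  div_pos (mul_pos h h') (predictive_pos hl hp h h')

lemma le_posterior (hl : ∀ θ, IsPmf fun ζ => l ζ θ) (hp : IsSubPmf p) {ζ : Z} {θ : Θ}
    (h' : 0 < l ζ θ) : l ζ θ * p θ ≤ posterior l p ζ θ := by
  rcases (hp.1 θ).eq_or_lt with h | h
  · simp [posterior, ← h]
  · unfold posterior
    rw [le_div_iff₀ (predictive_pos hl hp h h'), mul_comm (p θ)]
    exact mul_le_of_le_one_right (mul_pos h' h).le (predictive_le_one hl hp ζ)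

variable {T : Finset Θ} {l₀ : Z → ℝ}

omit [Fintype Z] in
lemma sum_posterior (hT : ∀ θ ∈ T, ∀ ζ, l ζ θ = l₀ ζ) (ζ : Z) :
    ∑ θ ∈ T, posterior l p ζ θ = (∑ θ ∈ T, p θ) * l₀ ζ / predictive l p ζ := by
  unfold posterior
  rw [← Finset.sum_div, Finset.sum_mul]
  congr 1
  exact Finset.sum_congr rfl fun θ hθ => by rw [hT θ hθ]

lemma residual_posterior_le (hl : ∀ θ, IsPmf fun ζ => l ζ θ) (hp : IsSubPmf p)
    (hT : ∀ θ ∈ T, ∀ ζ, l ζ θ = l₀ ζ) {δ : ℝ} (hδ : 0 < δ) (hδ1 : δ ≤ 1) {ζ : Z}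
    (hζ : δ ≤ l₀ ζ) : residual T (posterior l p ζ) ≤ 2 / δ * residual T p := by
  have h2 : 2 ≤ 2 / δ := by
    rw [le_div_iff₀ hδ]
    linarith
  have hr := residual_nonneg hp T
  rcases le_or_gt (1 / 2) (residual T p) with h | h
  · calc residual T (posterior l p ζ) ≤ 1 := residual_le_one (isSubPmf_posterior hl hp ζ) T
      _ ≤ 2 * residual T p := by linarith
      _ ≤ 2 / δ * residual T p := by gcongr
  · have hf : 1 / 2 < ∑ θ ∈ T, p θ := by
      unfold residual at h
      linarith
    have e : ∑ θ ∈ T, p θ * l ζ θ = (∑ θ ∈ T, p θ) * l₀ ζ := by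
      rw [Finset.sum_mul]
      exact Finset.sum_congr rfl fun θ hθ => by rw [hT θ hθ]
    have hm1 := le_predictive hl hp T ζ
    have hm2 := predictive_le hl hp T ζ
    rw [e] at hm1 hm2
    have hm3 : δ / 2 ≤ predictive l p ζ := by nlinarith
    have hm : 0 < predictive l p ζ := by linarith
    have : residual T (posterior l p ζ) =
        (predictive l p ζ - (∑ θ ∈ T, p θ) * l₀ ζ) / predictive l p ζ := by
      rw [residual, sum_posterior hT, sub_div, div_self hm.ne']
    rw [this, div_le_iff₀ hm]
    calc predictive l p ζ - (∑ θ ∈ T, p θ) * l₀ ζ ≤ residual T p := by linarith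
      _ = 2 / δ * residual T p * (δ / 2) := by field_simp
      _ ≤ 2 / δ * residual T p * predictive l p ζ := by gcongr

lemma sum_mul_residual_posterior_le (hl : ∀ θ, IsPmf fun ζ => l ζ θ) (hp : IsSubPmf p)
    (hT : ∀ θ ∈ T, ∀ ζ, l ζ θ = l₀ ζ) (hl₀ : IsPmf l₀) :
    ∑ ζ, l₀ ζ * residual T (posterior l p ζ) ≤ residual T p := by
  set f := ∑ θ ∈ T, p θ with hf
  have hf0 : 0 ≤ f := Finset.sum_nonneg fun θ _ => hp.1 θ
  have key : ∀ ζ, l₀ ζ * residual T (posterior l p ζ) ≤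
      l₀ ζ - f * (2 * l₀ ζ - predictive l p ζ) := by
    intro ζ
    have hm0 := predictive_nonneg hl hp ζ
    have e : ∑ θ ∈ T, p θ * l ζ θ = f * l₀ ζ := by
      rw [Finset.sum_mul]
      exact Finset.sum_congr rfl fun θ hθ => by rw [hT θ hθ]
    have hm1 := le_predictive hl hp T ζ
    rw [e] at hm1
    have hz := hl₀.1 ζ
    rw [residual, sum_posterior hT, ← hf]
    rcases hm0.eq_or_lt with h | h
    · rw [← h] at hm1 ⊢
      have : f * l₀ ζ = 0 := le_antisymm hm1 (mul_nonneg hf0 hz)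
      rw [div_zero]
      linarith
    · have : f * (2 * l₀ ζ - predictive l p ζ) ≤ l₀ ζ * (f * l₀ ζ / predictive l p ζ) := by
        rw [← mul_div_assoc, le_div_iff₀ h]
        nlinarith [mul_nonneg hf0 (sq_nonneg (l₀ ζ - predictive l p ζ))]
      linarith
  calc ∑ ζ, l₀ ζ * residual T (posterior l p ζ)
      ≤ ∑ ζ, (l₀ ζ - f * (2 * l₀ ζ - predictive l p ζ)) := Finset.sum_le_sum fun ζ _ => key ζ
    _ = 1 - f * (2 - ∑ ζ, predictive l p ζ) := by
        rw [Finset.sum_sub_distrib, ← Finset.mul_sum, Finset.sum_sub_distrib, ← Finset.mul_sum,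
          hl₀.2, mul_one]
    _ ≤ 1 - f * 1 := by
        have := sum_predictive_le_one hl hp
        gcongr
        linarith
    _ = residual T p := by rw [mul_one, residual]

lemma sum_mul_rpow_residual_posterior_le (hl : ∀ θ, IsPmf fun ζ => l ζ θ) (hp : IsSubPmf p)
    (hT : ∀ θ ∈ T, ∀ ζ, l ζ θ = l₀ ζ) (hl₀ : IsPmf l₀) {δ : ℝ} (hδ : 0 < δ) (hδ1 : δ ≤ 1)
    (hmin : ∀ ζ, 0 < l₀ ζ → δ ≤ l₀ ζ) {q : ℝ} (hq : 0 < q) :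
    ∑ ζ, l₀ ζ * residual T (posterior l p ζ) ^ (1 + q) ≤
      (2 / δ) ^ q * residual T p ^ (1 + q) := by
  have hr := residual_nonneg hp T
  calc ∑ ζ, l₀ ζ * residual T (posterior l p ζ) ^ (1 + q)
      ≤ ∑ ζ, (2 / δ * residual T p) ^ q * (l₀ ζ * residual T (posterior l p ζ)) := by
        refine Finset.sum_le_sum fun ζ _ => ?_
        have hr' := residual_nonneg (isSubPmf_posterior hl hp ζ) T
        rcases (hl₀.1 ζ).eq_or_lt with h | h
        · simp [← h]
        · rw [Real.rpow_add_of_nonneg hr' zero_le_one hq.le, Real.rpow_one, ← mul_assoc,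
            mul_comm _ (l₀ ζ * _)]
          gcongr
          exact residual_posterior_le hl hp hT hδ hδ1 (hmin ζ h)
    _ = (2 / δ * residual T p) ^ q * ∑ ζ, l₀ ζ * residual T (posterior l p ζ) := by
        rw [Finset.mul_sum]
    _ ≤ (2 / δ * residual T p) ^ q * residual T p := by
        gcongr
        exact sum_mul_residual_posterior_le hl hp hT hl₀
    _ = (2 / δ) ^ q * residual T p ^ (1 + q) := by
        rw [Real.mul_rpow (by positivity) hr, Real.rpow_add_of_nonneg hr zero_le_one hq.le,
          Real.rpow_one]
        ring

/-! ### The potential of the belief in the true state -/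

lemma surprise_nonneg {x : ℝ} (hx : 0 < x) (hx1 : x ≤ 1) : 0 ≤ surprise x := by
  have h1 : √x ≤ 1 := Real.sqrt_le_one.mpr hx1
  have := (one_le_inv₀ (Real.sqrt_pos.mpr hx)).mpr h1
  unfold surprise
  linarith

lemma surprise_pos {x : ℝ} (hx : 0 < x) (hx1 : x < 1) : 0 < surprise x := by
  have h1 : √x < 1 := by
    rw [Real.sqrt_lt' one_pos]
    linarith
  have := (one_lt_inv₀ (Real.sqrt_pos.mpr hx)).mpr h1
  unfold surprise
  linarith

/-- The tangent line inequality for `surprise`. -/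
lemma surprise_tangent {s t : ℝ} (hs : 0 < s) (ht : 0 < t) :
    surprise s - (t - s) / (2 * √s ^ 3) ≤ surprise t := by
  unfold surprise
  have hq := Real.sqrt_pos.mpr hs
  have hr := Real.sqrt_pos.mpr ht
  have es := Real.sq_sqrt hs.le
  have et := Real.sq_sqrt ht.le
  set q := √s
  set r := √t
  rw [← es, ← et]
  have : (r⁻¹ - 1) - (q⁻¹ - 1 - (r ^ 2 - q ^ 2) / (2 * q ^ 3)) =
      (q - r) ^ 2 * (2 * q + r) / (2 * q ^ 3 * r) := by
    field_simp
    ring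
  have : 0 ≤ (q - r) ^ 2 * (2 * q + r) / (2 * q ^ 3 * r) := by positivity
  linarith

lemma surprise_sum_le {ι : Type*} (I : Finset ι) {w x : ι → ℝ} (hw : ∀ j ∈ I, 0 ≤ w j)
    (hw1 : ∑ j ∈ I, w j = 1) (hx : ∀ j ∈ I, 0 < x j) :
    surprise (∑ j ∈ I, w j * x j) ≤ ∑ j ∈ I, w j * surprise (x j) := by
  have hs : 0 < ∑ j ∈ I, w j * x j := by
    obtain ⟨j, hj, hwj⟩ : ∃ j ∈ I, 0 < w j := by
      by_contra! h
      have := Finset.sum_nonpos h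
      linarith
    exact Finset.sum_pos' (fun j hj => mul_nonneg (hw j hj) (hx j hj).le)
      ⟨j, hj, mul_pos hwj (hx j hj)⟩
  set s := ∑ j ∈ I, w j * x j with hsdef
  calc surprise s = ∑ j ∈ I, w j * (surprise s - (x j - s) / (2 * √s ^ 3)) := by
        have : ∀ j ∈ I, w j * (surprise s - (x j - s) / (2 * √s ^ 3)) =
            w j * (surprise s + s / (2 * √s ^ 3)) - w j * x j / (2 * √s ^ 3) := by
          intro j _
          ring
        rw [Finset.sum_congr rfl this, Finset.sum_sub_distrib, ← Finset.sum_mul, hw1,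
          ← Finset.sum_div, ← hsdef]
        ring
    _ ≤ ∑ j ∈ I, w j * surprise (x j) :=
        Finset.sum_le_sum fun j hj =>
          mul_le_mul_of_nonneg_left (surprise_tangent hs (hx j hj)) (hw j hj)

lemma surprise_posterior_le (hl : ∀ θ, IsPmf fun ζ => l ζ θ) (hp : IsSubPmf p) {θ₀ : Θ}
    (h₀ : 0 < p θ₀) {δ : ℝ} (hδ : 0 < δ) (hδ1 : δ ≤ 1) {ζ : Z} (hζ : δ ≤ l ζ θ₀) :
    surprise (posterior l p ζ θ₀) ≤ 1 / δ * surprise (p θ₀) := by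
  have hz : 0 < l ζ θ₀ := hδ.trans_le hζ
  have hm := predictive_pos hl hp h₀ hz
  have hm2 := predictive_le hl hp {θ₀} ζ
  rw [residual, Finset.sum_singleton, Finset.sum_singleton] at hm2
  have hK : 1 ≤ 1 / δ := by
    rw [le_div_iff₀ hδ]
    linarith
  have hs := surprise_nonneg h₀ (hp.le_one θ₀)
  set K := 1 / δ with hKdef
  have e : (√(posterior l p ζ θ₀))⁻¹ = √(predictive l p ζ / (p θ₀ * l ζ θ₀)) := by
    rw [posterior, ← Real.sqrt_inv, inv_div]
  have hsq : ((√(p θ₀))⁻¹) ^ 2 = (p θ₀)⁻¹ := by rw [inv_pow, Real.sq_sqrt h₀.le]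
  have hb : predictive l p ζ / (p θ₀ * l ζ θ₀) ≤ 1 + K * ((p θ₀)⁻¹ - 1) := by
    have h1 : 0 ≤ (1 - p θ₀) / p θ₀ := div_nonneg (by linarith [hp.le_one θ₀]) h₀.le
    calc predictive l p ζ / (p θ₀ * l ζ θ₀)
        ≤ (p θ₀ * l ζ θ₀ + (1 - p θ₀)) / (p θ₀ * l ζ θ₀) := by gcongr
      _ = 1 + 1 / l ζ θ₀ * ((1 - p θ₀) / p θ₀) := by field_simp
      _ ≤ 1 + K * ((1 - p θ₀) / p θ₀) := by
          have : 1 / l ζ θ₀ ≤ K := one_div_le_one_div_of_le hδ hζ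
          gcongr
      _ = 1 + K * ((p θ₀)⁻¹ - 1) := by field_simp
  have : (√(posterior l p ζ θ₀))⁻¹ ≤ 1 + K * surprise (p θ₀) := by
    rw [e]
    refine Real.sqrt_le_iff.mpr ⟨by positivity, hb.trans ?_⟩
    rw [← hsq]
    unfold surprise at hs ⊢
    set t := (√(p θ₀))⁻¹
    nlinarith [mul_nonneg (mul_nonneg (zero_le_one.trans hK) (sub_nonneg.mpr hK)) (sq_nonneg (t - 1))]
  unfold surprise at this ⊢
  linarith

/-- The expected potential after one update decreases by at least the squared Hellinger distance
between the true law and the predictive law of the signal. -/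
lemma sum_mul_surprise_posterior_le (hl : ∀ θ, IsPmf fun ζ => l ζ θ) (hp : IsSubPmf p) {θ₀ : Θ}
    (h₀ : 0 < p θ₀) :
    ∑ ζ, l ζ θ₀ * surprise (posterior l p ζ θ₀) ≤
      surprise (p θ₀) - 1 / 2 * ∑ ζ, (√(l ζ θ₀) - √(predictive l p ζ)) ^ 2 := by
  have hinv : 1 ≤ (√(p θ₀))⁻¹ := by
    have := surprise_nonneg h₀ (hp.le_one θ₀)
    unfold surprise at this
    linarith
  have e : ∀ ζ, l ζ θ₀ * surprise (posterior l p ζ θ₀) =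
      (√(p θ₀))⁻¹ * (√(l ζ θ₀) * √(predictive l p ζ)) - l ζ θ₀ := by
    intro ζ
    have h0 := (hl θ₀).1 ζ
    rcases h0.eq_or_lt with h | h
    · simp only [] at h
      simp [← h]
    · have hm := predictive_pos hl hp h₀ h
      have h1 : √(l ζ θ₀) * √(l ζ θ₀) = l ζ θ₀ := Real.mul_self_sqrt h.le
      have h2 : 0 < √(l ζ θ₀) := Real.sqrt_pos.mpr h
      have h3 := Real.sqrt_pos.mpr h₀
      rw [surprise, posterior, Real.sqrt_div (mul_nonneg h₀.le h.le), Real.sqrt_mul h₀.le, inv_div,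
        mul_sub, mul_one]
      congr 1
      nth_rewrite 1 [← h1]
      field_simp
  have hsum : ∑ ζ, √(l ζ θ₀) * √(predictive l p ζ) ≤
      1 - 1 / 2 * ∑ ζ, (√(l ζ θ₀) - √(predictive l p ζ)) ^ 2 := by
    have : ∑ ζ, (√(l ζ θ₀) - √(predictive l p ζ)) ^ 2 =
        1 + ∑ ζ, predictive l p ζ - 2 * ∑ ζ, √(l ζ θ₀) * √(predictive l p ζ) := by
      rw [← (hl θ₀).2, ← Finset.sum_add_distrib, Finset.mul_sum, ← Finset.sum_sub_distrib]
      refine Finset.sum_congr rfl fun ζ _ => ?_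
      rw [sub_sq, Real.sq_sqrt ((hl θ₀).1 ζ), Real.sq_sqrt (predictive_nonneg hl hp ζ)]
      ring
    have := sum_predictive_le_one hl hp
    linarith
  have hH : 0 ≤ ∑ ζ, (√(l ζ θ₀) - √(predictive l p ζ)) ^ 2 :=
    Finset.sum_nonneg fun ζ _ => sq_nonneg _
  rw [Finset.sum_congr rfl fun ζ _ => e ζ, Finset.sum_sub_distrib, ← Finset.mul_sum, (hl θ₀).2]
  set H := ∑ ζ, (√(l ζ θ₀) - √(predictive l p ζ)) ^ 2
  calc (√(p θ₀))⁻¹ * ∑ ζ, √(l ζ θ₀) * √(predictive l p ζ) - 1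
      ≤ (√(p θ₀))⁻¹ * (1 - 1 / 2 * H) - 1 := by gcongr
    _ ≤ surprise (p θ₀) - 1 / 2 * H := by
        unfold surprise
        nlinarith

lemma prevailing_sq_le (hl : ∀ θ, IsPmf fun ζ => l ζ θ) (hp : IsSubPmf p) {θ₀ θ : Θ} {ζ₀ : Z}
    (hζ₀ : ∀ θ', l ζ₀ θ' ≤ l ζ₀ θ₀) :
    (l ζ₀ θ₀ - l ζ₀ θ) ^ 2 / 8 * p θ ^ 2 ≤
      1 / 2 * ∑ ζ, (√(l ζ θ₀) - √(predictive l p ζ)) ^ 2 := by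
  have hgap : (l ζ₀ θ₀ - l ζ₀ θ) * p θ ≤ l ζ₀ θ₀ - predictive l p ζ₀ := by
    have h1 : (l ζ₀ θ₀ - l ζ₀ θ) * p θ ≤ ∑ θ', (l ζ₀ θ₀ - l ζ₀ θ') * p θ' :=
      Finset.single_le_sum (f := fun θ' => (l ζ₀ θ₀ - l ζ₀ θ') * p θ')
        (fun θ' _ => mul_nonneg (sub_nonneg.mpr (hζ₀ θ')) (hp.1 θ')) (Finset.mem_univ θ)
    have h2 : ∑ θ', (l ζ₀ θ₀ - l ζ₀ θ') * p θ' = l ζ₀ θ₀ * ∑ θ', p θ' - predictive l p ζ₀ := by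
      rw [predictive, Finset.mul_sum, ← Finset.sum_sub_distrib]
      exact Finset.sum_congr rfl fun θ' _ => by ring
    have h3 : l ζ₀ θ₀ * ∑ θ', p θ' ≤ l ζ₀ θ₀ := mul_le_of_le_one_right ((hl θ₀).1 ζ₀) hp.2
    linarith
  have hgap0 : 0 ≤ (l ζ₀ θ₀ - l ζ₀ θ) * p θ :=
    mul_nonneg (sub_nonneg.mpr (hζ₀ θ)) (hp.1 θ)
  have hone : (√(l ζ₀ θ₀) - √(predictive l p ζ₀)) ^ 2 ≤
      ∑ ζ, (√(l ζ θ₀) - √(predictive l p ζ)) ^ 2 :=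
    Finset.single_le_sum (f := fun ζ => (√(l ζ θ₀) - √(predictive l p ζ)) ^ 2)
      (fun ζ _ => sq_nonneg _) (Finset.mem_univ ζ₀)
  have ha1 : √(l ζ₀ θ₀) ≤ 1 := Real.sqrt_le_one.mpr ((hl θ₀).isSubPmf.le_one ζ₀)
  have hb1 : √(predictive l p ζ₀) ≤ 1 := Real.sqrt_le_one.mpr (predictive_le_one hl hp ζ₀)
  have ha := Real.sqrt_nonneg (l ζ₀ θ₀)
  have hb := Real.sqrt_nonneg (predictive l p ζ₀)
  have ea := Real.sq_sqrt ((hl θ₀).1 ζ₀)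
  have eb := Real.sq_sqrt (predictive_nonneg hl hp ζ₀)
  simp only [] at ea
  set α := √(l ζ₀ θ₀)
  set β := √(predictive l p ζ₀)
  have h4 : (l ζ₀ θ₀ - predictive l p ζ₀) ^ 2 ≤ 4 * (α - β) ^ 2 := by
    rw [← ea, ← eb, sq_sub_sq, mul_pow]
    have : (α + β) ^ 2 ≤ 4 := by nlinarith
    gcongr
  have h5 : ((l ζ₀ θ₀ - l ζ₀ θ) * p θ) ^ 2 ≤ (l ζ₀ θ₀ - predictive l p ζ₀) ^ 2 := by gcongr
  rw [mul_pow] at h5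
  linarith

end Single

/-! ### Weights adapted to the network -/

/-- A nonnegative left-stochastic irreducible matrix has a positive fixed vector. -/
lemma exists_perron_vector {I : Type*} [Fintype I] [Nonempty I] (B : Matrix I I ℝ)
    (h0 : ∀ i j, 0 ≤ B i j) (h1 : ∀ j, ∑ i, B i j = 1)
    (hconn : ∀ i j, Relation.ReflTransGen (fun x y => 0 < B x y) i j) :
    ∃ y : I → ℝ, (∀ i, 0 < y i) ∧ ∀ i, ∑ j, B i j * y j = y i := by
  classical
  obtain ⟨v, hv0, hv⟩ : ∃ v ≠ 0, (B - 1).mulVec v = 0 := by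
    rw [Matrix.exists_mulVec_eq_zero_iff, ← Matrix.exists_vecMul_eq_zero_iff]
    refine ⟨1, one_ne_zero, ?_⟩
    ext j
    simp [Matrix.vecMul, dotProduct, Matrix.sub_apply, h1, Matrix.one_apply]
  have hv' : ∀ i, ∑ j, B i j * v j = v i := by
    intro i
    have := congrFun hv i
    rw [Matrix.sub_mulVec, Matrix.one_mulVec] at this
    simpa [Matrix.mulVec, dotProduct, sub_eq_zero] using this
  have hle : ∀ i ∈ Finset.univ, |v i| ≤ ∑ j, B i j * |v j| := by
    intro i _
    rw [← hv' i]
    refine (Finset.abs_sum_le_sum_abs _ _).trans (Finset.sum_le_sum fun j _ => ?_)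
    rw [abs_mul, abs_of_nonneg (h0 i j)]
  have hsum : ∑ i, |v i| = ∑ i, ∑ j, B i j * |v j| := by
    rw [Finset.sum_comm]
    exact Finset.sum_congr rfl fun j _ => by rw [← Finset.sum_mul, h1, one_mul]
  have heq : ∀ i, ∑ j, B i j * |v j| = |v i| := fun i =>
    ((Finset.sum_eq_sum_iff_of_le hle).mp hsum i (Finset.mem_univ i)).symm
  obtain ⟨j₀, hj₀⟩ := Function.ne_iff.mp hv0
  refine ⟨fun i => |v i|, fun i => ?_, heq⟩
  refine (hconn i j₀).head_induction_on (abs_pos.mpr hj₀) fun {x z} hxz _ hz => ?_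
  change 0 < |v x|
  rw [← heq x]
  exact Finset.sum_pos' (fun j _ => mul_nonneg (h0 x j) (abs_nonneg _))
    ⟨z, Finset.mem_univ z, mul_pos hxz hz⟩

section Network

variable {V : Type*} [Fintype V] {S R : ℕ} {net : V → Fin S ⊕ Fin R} {a : Matrix V V ℝ}

/-- Every sending sub-network carries a positive vector that is fixed by the weights. -/
lemma IsWeakNetwork.exists_perron (hnet : IsWeakNetwork net a) (s : Fin S) :
    ∃ y : V → ℝ, (∀ k, net k = Sum.inl s → 0 < y k) ∧ (∀ k, net k ≠ Sum.inl s → y k = 0) ∧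
      ∀ ℓ, ∑ k, a ℓ k * y k = y ℓ := by
  classical
  obtain ⟨hconn, c, hc, -⟩ := hnet.sending_connected s
  have : Nonempty {k // net k = Sum.inl s} := ⟨⟨c, hc⟩⟩
  have hsub : ∀ (f : V → ℝ), (∀ k, net k ≠ Sum.inl s → f k = 0) →
      ∑ k : {k // net k = Sum.inl s}, f k = ∑ k, f k := by
    intro f hf
    rw [← Finset.sum_subtype (Finset.univ.filter fun k => net k = Sum.inl s) (by simp) f]
    refine Finset.sum_filter_of_ne fun x _ hx => ?_
    by_contra h
    exact hx (hf x h)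
  obtain ⟨y, hy0, hy⟩ := exists_perron_vector
    (fun i j : {k // net k = Sum.inl s} => a i j) (fun i j => hnet.nonneg _ _)
    (fun j => by
      rw [hsub fun i => a i j]
      · exact hnet.sum_eq_one j
      · exact fun k hk => hnet.sending_closed k j s j.2 hk)
    (fun i j => by
      have h := hconn i i.2 j j.2
      suffices ∀ (x : V), Relation.ReflTransGen
          (fun x y => x ∈ {k | net k = Sum.inl s} ∧ y ∈ {k | net k = Sum.inl s} ∧ 0 < a x y) i x →
          ∀ hx : net x = Sum.inl s, Relation.ReflTransGen
            (fun x y : {k // net k = Sum.inl s} => 0 < a x y) i ⟨x, hx⟩ from this j h j.2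
      intro x hx
      induction hx with
      | refl => exact fun _ => Relation.ReflTransGen.refl
      | tail _ hyz ih => exact fun hz => (ih hyz.1).tail hyz.2.2)
  refine ⟨fun k => if h : net k = Sum.inl s then y ⟨k, h⟩ else 0, fun k hk => ?_, fun k hk => ?_,
    fun ℓ => ?_⟩
  · simp [hk, hy0]
  · simp [hk]
  · rw [← hsub]
    · have e : ∀ k : {k // net k = Sum.inl s},
          a ℓ k * (if h : net k = Sum.inl s then y ⟨k, h⟩ else 0) = a ℓ k * y k := by
        intro k
        rw [dif_pos k.2]
      rw [Finset.sum_congr rfl fun k _ => e k]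
      beta_reduce
      split_ifs with h
      · exact hy ⟨ℓ, h⟩
      · exact Finset.sum_eq_zero fun k _ => by rw [hnet.sending_closed ℓ k s k.2 h, zero_mul]
    · intro k hk
      beta_reduce
      rw [dif_neg hk, mul_zero]

/-- Every agent is reached from the sending sub-networks along positive weights. -/
lemma IsWeakNetwork.forall_of_closed (hnet : IsWeakNetwork net a) {C : V → Prop}
    (hS : ∀ k s, net k = Sum.inl s → C k) (hstep : ∀ ℓ k, 0 < a ℓ k → C ℓ → C k) (k : V) :
    C k := by
  have hR : ∀ r k, net k = Sum.inr r → C k := by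
    intro r
    induction r using WellFoundedLT.induction with
    | ind r ih =>
      intro k hk
      obtain ⟨ℓ₀, k₀, hℓ₀, hk₀, hpos⟩ := hnet.receiving_fed r
      have h₀ : C ℓ₀ := by
        rcases h : net ℓ₀ with s | r'
        · exact hS ℓ₀ s h
        · refine ih r' ?_ ℓ₀ h
          have hne : r' ≠ r := fun e => hℓ₀ (e ▸ h)
          refine lt_of_le_of_ne (not_lt.mp fun hlt => ?_) hne
          exact hpos.ne' (hnet.receiving_triangular ℓ₀ k₀ r r' h hk₀ hlt)
      have := hnet.receiving_connected r k₀ hk₀ k hk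
      induction this with
      | refl => exact hstep ℓ₀ k₀ hpos h₀
      | tail _ hyz ih' => exact hstep _ _ hyz.2.2 (ih' hyz.1)
  rcases h : net k with s | r
  · exact hS k s h
  · exact hR r k h

/-- The agents have ranks such that every receiving agent listens to an agent of smaller rank. -/
lemma IsWeakNetwork.exists_rank (hnet : IsWeakNetwork net a) :
    ∃ d : V → ℕ, (∀ k s, net k = Sum.inl s → d k = 0) ∧
      ∀ k r, net k = Sum.inr r → ∃ ℓ, 0 < a ℓ k ∧ d ℓ < d k := by
  let Q : ℕ → V → Prop := fun n => n.rec (fun k => ∃ s, net k = Sum.inl s)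
    fun _ P k => ∃ ℓ, 0 < a ℓ k ∧ P ℓ
  have hQ : ∀ k, ∃ n, Q n k := hnet.forall_of_closed (C := fun k => ∃ n, Q n k)
    (fun k s h => ⟨0, s, h⟩) fun ℓ k h ⟨n, hn⟩ => ⟨n + 1, ℓ, h, hn⟩
  have hmin : ∀ k, ∃ n, Q n k ∧ ∀ m, Q m k → n ≤ m := fun k =>
    ⟨sInf {n | Q n k}, Nat.sInf_mem (hQ k), fun m hm => Nat.sInf_le hm⟩
  choose d hd hdmin using hmin
  refine ⟨d, fun k s h => Nat.le_zero.mp (hdmin k 0 ⟨s, h⟩), fun k r h => ?_⟩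
  have hk := hd k
  rcases hn : d k with _ | n
  · rw [hn] at hk
    obtain ⟨s, hs⟩ := hk
    simp [h] at hs
  · rw [hn] at hk
    obtain ⟨ℓ, hℓ, hQℓ⟩ := hk
    exact ⟨ℓ, hℓ, Nat.lt_succ_of_le (hdmin ℓ n hQℓ)⟩

lemma exists_pos_le {ι : Type*} [Finite ι] (f : ι → ℝ) :
    ∃ δ : ℝ, 0 < δ ∧ δ ≤ 1 ∧ ∀ i, 0 < f i → δ ≤ f i := by
  classical
  have := Fintype.ofFinite ι
  have : ∀ T : Finset ι, ∃ δ : ℝ, 0 < δ ∧ δ ≤ 1 ∧ ∀ i ∈ T, 0 < f i → δ ≤ f i := by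
    intro T
    induction T using Finset.induction_on with
    | empty => exact ⟨1, one_pos, le_rfl, by simp⟩
    | insert i T _ ih =>
      obtain ⟨δ, h0, h1, h⟩ := ih
      by_cases hi : 0 < f i
      · refine ⟨min δ (f i), lt_min h0 hi, (min_le_left _ _).trans h1, fun j hj hpos => ?_⟩
        rcases Finset.mem_insert.mp hj with rfl | hj
        · exact min_le_right _ _
        · exact (min_le_left _ _).trans (h j hj hpos)
      · refine ⟨δ, h0, h1, fun j hj hpos => ?_⟩
        rcases Finset.mem_insert.mp hj with rfl | hj
        · exact absurd hpos hi
        · exact h j hj hpos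
  obtain ⟨δ, h0, h1, h⟩ := this Finset.univ
  exact ⟨δ, h0, h1, fun i => h i (Finset.mem_univ i)⟩

/-- The weights among receiving agents are a strict contraction in a suitable weighted norm. -/
lemma IsWeakNetwork.exists_contraction (hnet : IsWeakNetwork net a) :
    ∃ (u : V → ℝ) (ρ : ℝ), ρ < 1 ∧ 0 ≤ ρ ∧ (∀ k s, net k = Sum.inl s → u k = 0) ∧
      (∀ k r, net k = Sum.inr r → 0 < u k) ∧
      ∀ k r, net k = Sum.inr r → ∑ ℓ, a ℓ k * u ℓ ≤ ρ * u k := by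
  obtain ⟨d, hd0, hd⟩ := hnet.exists_rank
  obtain ⟨α, hα0, hα1, hα⟩ := exists_pos_le fun x : V × V => a x.1 x.2
  set η := α / 2 with hη
  have hη0 : 0 < η := by positivity
  have hη1 : η < 1 := by linarith
  have hu0 : ∀ k, 0 ≤ 1 - η ^ d k := fun k => sub_nonneg.mpr (pow_le_one₀ hη0.le hη1.le)
  have hupos : ∀ k r, net k = Sum.inr r → 0 < 1 - η ^ d k := by
    intro k r h
    obtain ⟨ℓ, -, hlt⟩ := hd k r h
    exact sub_pos.mpr (pow_lt_one₀ hη0.le hη1 (by omega))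
  have hstrict : ∀ k r, net k = Sum.inr r →
      ∑ ℓ, a ℓ k * (1 - η ^ d ℓ) ≤ 1 - η ^ d k - η ^ d k := by
    intro k r h
    obtain ⟨ℓ, hpos, hlt⟩ := hd k r h
    have h1 : a ℓ k * η ^ d ℓ ≤ ∑ ℓ, a ℓ k * η ^ d ℓ :=
      Finset.single_le_sum (f := fun ℓ => a ℓ k * η ^ d ℓ)
        (fun j _ => mul_nonneg (hnet.nonneg j k) (pow_nonneg hη0.le _)) (Finset.mem_univ ℓ)
    have h2 : η ^ d k ≤ η ^ d ℓ * η := by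
      rw [← pow_succ]
      exact pow_le_pow_of_le_one hη0.le hη1.le hlt
    have h3 : α * η ^ d ℓ ≤ a ℓ k * η ^ d ℓ := by
      have := hα (ℓ, k) hpos
      gcongr
    have h4 : ∑ ℓ, a ℓ k * (1 - η ^ d ℓ) = 1 - ∑ ℓ, a ℓ k * η ^ d ℓ := by
      simp only [mul_sub, mul_one, Finset.sum_sub_distrib, hnet.sum_eq_one k]
    have h5 : α = 2 * η := by linarith
    rw [h4]
    rw [h5] at h3
    linarith
  obtain ⟨β, hβ0, hβ1, hβ⟩ := exists_pos_le fun k : V => η ^ d k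
  refine ⟨fun k => 1 - η ^ d k, 1 - β, by linarith, by linarith,
    fun k s h => by simp [hd0 k s h], hupos, fun k r h => (hstrict k r h).trans ?_⟩
  have h1 := hβ k (pow_pos hη0 _)
  have h2 : 0 ≤ η ^ d k := (pow_pos hη0 _).le
  have h3 : η ^ d k ≤ 1 := pow_le_one₀ hη0.le hη1.le
  nlinarith

/-- Summability is passed on from the sending agents to the receiving agents, as soon as the growth
factor `κ` does not outweigh the contraction. -/
lemma summable_of_contraction (hnet : IsWeakNetwork net a) {u : V → ℝ} {ρ κ : ℝ}
    (huS : ∀ k s, net k = Sum.inl s → u k = 0) (huR : ∀ k r, net k = Sum.inr r → 0 < u k)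
    (hu : ∀ k r, net k = Sum.inr r → ∑ ℓ, a ℓ k * u ℓ ≤ ρ * u k) (hκ : 0 ≤ κ) (hκρ : κ * ρ < 1)
    {c : V → ℕ → ℝ} (hc : ∀ k i, 0 ≤ c k i) (hcS : ∀ k s, net k = Sum.inl s → Summable (c k))
    (hcR : ∀ k r, net k = Sum.inr r → ∀ i, c k (i + 1) ≤ κ * ∑ ℓ, a ℓ k * c ℓ i)
    (k : V) : Summable (c k) := by
  have hu0 : ∀ k, 0 ≤ u k := by
    intro k
    rcases h : net k with s | r
    · exact (huS k s h).ge
    · exact (huR k r h).le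
  have hρ : 0 < 1 - κ * ρ := by linarith
  set b : V → ℝ := fun ℓ => Sum.elim (fun _ => ∑' i, c ℓ i) (fun _ => 0) (net ℓ) with hb
  have hb0 : ∀ ℓ, 0 ≤ b ℓ := by
    intro ℓ
    rcases h : net ℓ with s | r <;> simp only [hb, h, Sum.elim_inl, Sum.elim_inr, le_refl]
    exact tsum_nonneg (hc ℓ)
  set e : V → ℝ := fun k => (c k 0 + κ * ∑ ℓ, a ℓ k * b ℓ) / ((1 - κ * ρ) * u k) with he
  have hnum : ∀ k, 0 ≤ c k 0 + κ * ∑ ℓ, a ℓ k * b ℓ := fun k =>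
    add_nonneg (hc k 0) (mul_nonneg hκ
      (Finset.sum_nonneg fun ℓ _ => mul_nonneg (hnet.nonneg ℓ k) (hb0 ℓ)))
  have he0 : ∀ k, 0 ≤ e k := fun k => div_nonneg (hnum k) (mul_nonneg hρ.le (hu0 k))
  set M := ∑ k, e k with hM
  have hM0 : 0 ≤ M := Finset.sum_nonneg fun k _ => he0 k
  have key : ∀ n ℓ, ∑ i ∈ Finset.range n, c ℓ i ≤ M * u ℓ + b ℓ := by
    intro n
    induction n with
    | zero =>
      intro ℓ
      simpa using add_nonneg (mul_nonneg hM0 (hu0 ℓ)) (hb0 ℓ)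
    | succ n ih =>
      intro k
      rcases h : net k with s | r
      · simp only [hb, h, huS k s h, Sum.elim_inl, mul_zero, zero_add]
        exact (hcS k s h).sum_le_tsum _ fun i _ => hc k i
      · have hbk : b k = 0 := by simp only [hb, h, Sum.elim_inr]
        have hek : c k 0 + κ * ∑ ℓ, a ℓ k * b ℓ ≤ M * ((1 - κ * ρ) * u k) := by
          rw [← div_le_iff₀ (mul_pos hρ (huR k r h))]
          exact Finset.single_le_sum (fun k _ => he0 k) (Finset.mem_univ k)
        rw [Finset.sum_range_succ', hbk, add_zero]
        calc ∑ i ∈ Finset.range n, c k (i + 1) + c k 0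
            ≤ ∑ i ∈ Finset.range n, κ * ∑ ℓ, a ℓ k * c ℓ i + c k 0 := by
              gcongr with i _
              exact hcR k r h i
          _ = κ * ∑ ℓ, a ℓ k * ∑ i ∈ Finset.range n, c ℓ i + c k 0 := by
              rw [← Finset.mul_sum, Finset.sum_comm]
              simp only [Finset.mul_sum]
          _ ≤ κ * ∑ ℓ, a ℓ k * (M * u ℓ + b ℓ) + c k 0 := by
              gcongr with ℓ _
              · exact hnet.nonneg ℓ k
              · exact ih ℓ
          _ = κ * M * ∑ ℓ, a ℓ k * u ℓ + (c k 0 + κ * ∑ ℓ, a ℓ k * b ℓ) := by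
              simp only [mul_add, Finset.sum_add_distrib, Finset.mul_sum]
              have : ∀ ℓ, κ * (a ℓ k * (M * u ℓ)) = κ * M * (a ℓ k * u ℓ) := fun ℓ => by ring
              simp only [this]
              ring
          _ ≤ κ * M * (ρ * u k) + M * ((1 - κ * ρ) * u k) := by
              gcongr
              exact hu k r h
          _ = M * u k := by ring
  exact summable_of_sum_range_le (hc k) fun n => key n k

end Network

/-! ### Beliefs as random variables -/

section RandomBelief

variable {V Θ Ω : Type*} {Z : V → Type*} [Fintype V] [Fintype Θ] [∀ k, Fintype (Z k)]
  {a : Matrix V V ℝ} {L : ∀ k, Z k → Θ → ℝ} {μ₀ : V → Θ → ℝ}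

omit [∀ k, Fintype (Z k)] in
/-- The beliefs at time `i` are a function of the first `i` signals. -/
lemma exists_belief_eq_history (a : Matrix V V ℝ) (L : ∀ k, Z k → Θ → ℝ) (μ₀ : V → Θ → ℝ) (i : ℕ) :
    ∃ Φ : (Finset.range i → ∀ k, Z k) → V → Θ → ℝ,
      ∀ x : ℕ → ∀ k, Z k, belief a L μ₀ x i = Φ fun j => x (j + 1) := by
  induction i with
  | zero => exact ⟨fun _ => μ₀, fun _ => rfl⟩
  | succ i ih =>
    obtain ⟨Φ, hΦ⟩ := ih
    refine ⟨fun h k θ => ∑ ℓ, a ℓ k * bayesUpdate L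
      (Φ fun j => h ⟨j, Finset.mem_range.mpr ((Finset.mem_range.mp j.2).trans (Nat.lt_succ_self i))⟩)
      (h ⟨i, Finset.self_mem_range_succ i⟩) ℓ θ, fun x => ?_⟩
    rw [belief, hΦ]

variable [∀ k, MeasurableSpace (Z k)] [∀ k, DiscreteMeasurableSpace (Z k)]
  [MeasurableSpace Ω] {P : Measure Ω} [IsProbabilityMeasure P] {θ₀ : V → Θ}
  {ξ : ℕ → Ω → ∀ k, Z k}

omit [Fintype Θ] [IsProbabilityMeasure P] [∀ k, DiscreteMeasurableSpace (Z k)]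
  [∀ k, Fintype (Z k)] [Fintype V] in
lemma IsSignalProcess.measurable_history (hξ : IsSignalProcess P L θ₀ ξ) (i : ℕ) :
    Measurable fun ω (j : Finset.range i) => ξ (j + 1) ω :=
  measurable_pi_lambda _ fun j => hξ.measurable (j + 1) (Nat.le_add_left 1 j)

omit [Fintype Θ] in
lemma IsSignalProcess.integrable_comp_history (hξ : IsSignalProcess P L θ₀ ξ) (i : ℕ)
    (F : (Finset.range i → ∀ k, Z k) → ℝ) :
    Integrable (fun ω => F fun j => ξ (j + 1) ω) P := by
  have hF : Measurable F := measurable_of_countable F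
  obtain ⟨C, hC⟩ := (Set.finite_range fun h => ‖F h‖).bddAbove
  exact Integrable.of_bound (hF.comp (hξ.measurable_history i)).aestronglyMeasurable C
    (ae_of_all _ fun ω => hC ⟨_, rfl⟩)

lemma IsSignalProcess.integrable_belief (hξ : IsSignalProcess P L θ₀ ξ) (i : ℕ)
    (f : (V → Θ → ℝ) → ℝ) :
    Integrable (fun ω => f (belief a L μ₀ (fun j => ξ j ω) i)) P := by
  obtain ⟨Φ, hΦ⟩ := exists_belief_eq_history a L μ₀ i
  simp only [hΦ]
  exact hξ.integrable_comp_history i fun h => f (Φ h)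

lemma IsSignalProcess.integrable_belief_signal (hξ : IsSignalProcess P L θ₀ ξ) (i : ℕ) (ℓ : V)
    (f : (V → Θ → ℝ) → Z ℓ → ℝ) :
    Integrable (fun ω => f (belief a L μ₀ (fun j => ξ j ω) i) (ξ (i + 1) ω ℓ)) P := by
  obtain ⟨Φ, hΦ⟩ := exists_belief_eq_history a L μ₀ i
  simp only [hΦ]
  exact hξ.integrable_comp_history (i + 1) fun h =>
    f (Φ fun j => h ⟨j, Finset.mem_range.mpr ((Finset.mem_range.mp j.2).trans (Nat.lt_succ_self i))⟩)
      (h ⟨i, Finset.self_mem_range_succ i⟩ ℓ)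

omit [Fintype V] [Fintype Θ] [∀ k, Fintype (Z k)] [∀ k, DiscreteMeasurableSpace (Z k)]
  [IsProbabilityMeasure P] in
lemma IsSignalProcess.indepFun_history (hξ : IsSignalProcess P L θ₀ ξ) (i : ℕ) :
    IndepFun (fun ω (j : Finset.range i) => ξ (j + 1) ω) (ξ (i + 1)) P := by
  have h := hξ.indep.indepFun_finset (Finset.range i) {i} (by simp)
    fun j => hξ.measurable (j + 1) (Nat.le_add_left 1 j)
  exact h.comp measurable_id
    (measurable_pi_apply (⟨i, Finset.mem_singleton_self i⟩ : ({i} : Finset ℕ)))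

/-- The signal at time `i + 1` may be averaged out, given the beliefs at time `i`. -/
lemma IsSignalProcess.integral_belief_signal (hξ : IsSignalProcess P L θ₀ ξ) (i : ℕ) (ℓ : V)
    (f : (V → Θ → ℝ) → Z ℓ → ℝ) :
    ∫ ω, f (belief a L μ₀ (fun j => ξ j ω) i) (ξ (i + 1) ω ℓ) ∂P =
      ∫ ω, ∑ ζ, L ℓ ζ (θ₀ ℓ) * f (belief a L μ₀ (fun j => ξ j ω) i) ζ ∂P := by
  classical
  have hmeas : ∀ ζ : Z ℓ, MeasurableSet {ω | ξ (i + 1) ω ℓ = ζ} := fun ζ =>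
    ((measurable_pi_apply ℓ).comp (hξ.measurable (i + 1) (Nat.le_add_left 1 i)))
      (MeasurableSet.singleton ζ)
  obtain ⟨Φ, hΦ⟩ := exists_belief_eq_history a L μ₀ i
  have hsplit : ∀ ω, f (belief a L μ₀ (fun j => ξ j ω) i) (ξ (i + 1) ω ℓ) =
      ∑ ζ, (if ξ (i + 1) ω ℓ = ζ then (1 : ℝ) else 0) *
        f (belief a L μ₀ (fun j => ξ j ω) i) ζ := by
    intro ω
    simp
  have hI : ∀ ζ, Integrable (fun ω => (if ξ (i + 1) ω ℓ = ζ then (1 : ℝ) else 0) *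
        f (belief a L μ₀ (fun j => ξ j ω) i) ζ) P := fun ζ =>
    hξ.integrable_belief_signal i ℓ fun μ z => (if z = ζ then (1 : ℝ) else 0) * f μ ζ
  have hI' : ∀ ζ, Integrable (fun ω => L ℓ ζ (θ₀ ℓ) *
        f (belief a L μ₀ (fun j => ξ j ω) i) ζ) P := fun ζ =>
    hξ.integrable_belief i fun μ => L ℓ ζ (θ₀ ℓ) * f μ ζ
  simp only [hsplit]
  rw [integral_finsetSum _ fun ζ _ => hI ζ, integral_finsetSum _ fun ζ _ => hI' ζ]
  refine Finset.sum_congr rfl fun ζ _ => ?_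
  have hind : IndepFun (fun ω => if ξ (i + 1) ω ℓ = ζ then (1 : ℝ) else 0)
      (fun ω => f (belief a L μ₀ (fun j => ξ j ω) i) ζ) P := by
    simp only [hΦ]
    exact (hξ.indepFun_history i).symm.comp
      (φ := fun z : ∀ k, Z k => if z ℓ = ζ then (1 : ℝ) else 0) (ψ := fun h => f (Φ h) ζ)
      (measurable_of_countable _) (measurable_of_countable _)
  rw [hind.integral_fun_mul_eq_mul_integral
      (hξ.integrable_belief_signal (a := a) (μ₀ := μ₀) i ℓ
        fun _ z => if z = ζ then (1 : ℝ) else 0).aestronglyMeasurable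
      (hξ.integrable_belief i fun μ => f μ ζ).aestronglyMeasurable, integral_const_mul]
  congr 1
  rw [← hξ.law (i + 1) (Nat.le_add_left 1 i) ℓ ζ, ← integral_indicator_one (hmeas ζ)]
  rfl

/-- A signal path along which every observed signal has positive likelihood under the true state. -/
def IsAdmissible {V Θ : Type*} {Z : V → Type*} (L : ∀ k, Z k → Θ → ℝ) (θ₀ : V → Θ)
    (x : ℕ → ∀ k, Z k) : Prop :=
  ∀ i k, 0 < L k (x (i + 1) k) (θ₀ k)

omit [Fintype Θ] [∀ k, DiscreteMeasurableSpace (Z k)] in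
lemma IsSignalProcess.ae_isAdmissible (hξ : IsSignalProcess P L θ₀ ξ)
    (hL : ∀ k θ, IsPmf fun ζ : Z k => L k ζ θ) :
    ∀ᵐ ω ∂P, IsAdmissible L θ₀ fun j => ξ j ω := by
  unfold IsAdmissible
  rw [ae_all_iff]
  intro i
  rw [ae_all_iff]
  intro k
  have : ∀ᵐ ω ∂P, ∀ ζ : Z k, L k ζ (θ₀ k) = 0 → ξ (i + 1) ω k ≠ ζ := by
    rw [ae_all_iff]
    intro ζ
    by_cases h : L k ζ (θ₀ k) = 0
    · have h0 := hξ.law (i + 1) (Nat.le_add_left 1 i) k ζ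
      rw [h, measureReal_eq_zero_iff] at h0
      rw [ae_iff]
      simpa [h] using h0
    · simp [h]
  filter_upwards [this] with ω hω
  exact lt_of_le_of_ne ((hL k (θ₀ k)).1 _) fun h => hω _ h.symm rfl

omit [IsProbabilityMeasure P] in
/-- Nonnegative random variables with summable expectations converge to zero almost surely. -/
lemma ae_tendsto_zero_of_summable_integral {f : ℕ → Ω → ℝ} (hf : ∀ i, Integrable (f i) P)
    (h0 : ∀ i, 0 ≤ᵐ[P] f i) (hs : Summable fun i => ∫ ω, f i ω ∂P) :
    ∀ᵐ ω ∂P, Tendsto (fun i => f i ω) atTop (𝓝 0) := by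
  have h1 : ∫⁻ ω, ∑' i, ENNReal.ofReal (f i ω) ∂P ≠ ⊤ := by
    rw [lintegral_tsum fun i => (hf i).aemeasurable.ennreal_ofReal]
    have : ∀ i, ∫⁻ ω, ENNReal.ofReal (f i ω) ∂P = ENNReal.ofReal (∫ ω, f i ω ∂P) := fun i =>
      (ofReal_integral_eq_lintegral_ofReal (hf i) (h0 i)).symm
    simp only [this]
    exact hs.tsum_ofReal_ne_top
  have h2 := ae_lt_top' (AEMeasurable.tsum fun i => (hf i).aemeasurable.ennreal_ofReal) h1
  filter_upwards [h2, ae_all_iff.mpr h0] with ω hω h0ω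
  have h3 := ENNReal.tendsto_atTop_zero_of_tsum_ne_top hω.ne
  have h4 := (ENNReal.tendsto_toReal ENNReal.zero_ne_top).comp h3
  simpa [Function.comp_def, ENNReal.toReal_ofReal (h0ω _)] using h4

end RandomBelief

/-! ### One step of the diffusion strategy -/

/-- The beliefs after the signals `z` and one combination step. -/
def diffuse {V Θ : Type*} {Z : V → Type*} [Fintype V] [Fintype Θ] (a : Matrix V V ℝ)
    (L : ∀ k, Z k → Θ → ℝ) (μ : V → Θ → ℝ) (z : ∀ k, Z k) (k : V) (θ : Θ) : ℝ :=
  ∑ ℓ, a ℓ k * posterior (L ℓ) (μ ℓ) (z ℓ) θ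

/-- The weighted potential of the beliefs in the state `θ`. -/
def potential {V Θ : Type*} [Fintype V] (y : V → ℝ) (θ : Θ) (μ : V → Θ → ℝ) : ℝ :=
  ∑ k, y k * surprise (μ k θ)

/-- The support of the weights `y` is the sending sub-network `s`, and `a` fixes `y`. -/
structure IsPerronWeight {V : Type*} [Fintype V] {S R : ℕ} (net : V → Fin S ⊕ Fin R)
    (a : Matrix V V ℝ) (s : Fin S) (y : V → ℝ) : Prop where
  pos : ∀ k, net k = Sum.inl s → 0 < y k
  eq_zero : ∀ k, net k ≠ Sum.inl s → y k = 0
  fixed : ∀ ℓ, ∑ k, a ℓ k * y k = y ℓ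

section Step

variable {V Θ : Type*} {Z : V → Type*} [Fintype V] [Fintype Θ] [∀ k, Fintype (Z k)]
  {S R : ℕ} {net : V → Fin S ⊕ Fin R} {a : Matrix V V ℝ} {L : ∀ k, Z k → Θ → ℝ}
  {μ : V → Θ → ℝ} {z : ∀ k, Z k}

omit [∀ k, Fintype (Z k)] in
lemma belief_succ (a : Matrix V V ℝ) (L : ∀ k, Z k → Θ → ℝ) (μ₀ : V → Θ → ℝ)
    (x : ℕ → ∀ k, Z k) (i : ℕ) :
    belief a L μ₀ x (i + 1) = diffuse a L (belief a L μ₀ x i) (x (i + 1)) :=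
  rfl

lemma isSubPmf_diffuse (hnet : IsWeakNetwork net a) (hL : ∀ k θ, IsPmf fun ζ : Z k => L k ζ θ)
    (hμ : ∀ k, IsSubPmf (μ k)) (k : V) : IsSubPmf (diffuse a L μ z k) := by
  have hpost := fun ℓ => isSubPmf_posterior (hL ℓ) (hμ ℓ) (z ℓ)
  refine ⟨fun θ => Finset.sum_nonneg fun ℓ _ => mul_nonneg (hnet.nonneg ℓ k) ((hpost ℓ).1 θ), ?_⟩
  unfold diffuse
  rw [Finset.sum_comm]
  simp only [← Finset.mul_sum]
  calc ∑ ℓ, a ℓ k * ∑ θ, posterior (L ℓ) (μ ℓ) (z ℓ) θ ≤ ∑ ℓ, a ℓ k * 1 :=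
        Finset.sum_le_sum fun ℓ _ => mul_le_mul_of_nonneg_left (hpost ℓ).2 (hnet.nonneg ℓ k)
    _ = 1 := by simp only [mul_one, hnet.sum_eq_one]

lemma isPmf_diffuse (hnet : IsWeakNetwork net a) (hL : ∀ k θ, IsPmf fun ζ : Z k => L k ζ θ)
    (hμ : ∀ k, IsSubPmf (μ k)) {s : Fin S} {θ : Θ} (hpos : ∀ ℓ, net ℓ = Sum.inl s → 0 < μ ℓ θ)
    (hz : ∀ ℓ, net ℓ = Sum.inl s → 0 < L ℓ (z ℓ) θ) {k : V} (hk : net k = Sum.inl s) :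
    IsPmf (diffuse a L μ z k) := by
  refine ⟨(isSubPmf_diffuse hnet hL hμ k).1, ?_⟩
  unfold diffuse
  rw [Finset.sum_comm]
  simp only [← Finset.mul_sum]
  rw [← hnet.sum_eq_one k]
  refine Finset.sum_congr rfl fun ℓ _ => ?_
  by_cases hℓ : net ℓ = Sum.inl s
  · rw [(isPmf_posterior (hL ℓ) (hμ ℓ) (predictive_pos (hL ℓ) (hμ ℓ) (hpos ℓ hℓ) (hz ℓ hℓ))).2,
      mul_one]
  · rw [hnet.sending_closed ℓ k s hk hℓ, zero_mul]

lemma mul_le_diffuse (hnet : IsWeakNetwork net a) (hL : ∀ k θ, IsPmf fun ζ : Z k => L k ζ θ)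
    (hμ : ∀ k, IsSubPmf (μ k)) {ℓ k : V} {θ : Θ} (hz : 0 < L ℓ (z ℓ) θ) :
    a ℓ k * (L ℓ (z ℓ) θ * μ ℓ θ) ≤ diffuse a L μ z k θ :=
  (mul_le_mul_of_nonneg_left (le_posterior (hL ℓ) (hμ ℓ) hz) (hnet.nonneg ℓ k)).trans
    (Finset.single_le_sum (f := fun ℓ => a ℓ k * posterior (L ℓ) (μ ℓ) (z ℓ) θ)
      (fun j _ => mul_nonneg (hnet.nonneg j k) ((isSubPmf_posterior (hL j) (hμ j) (z j)).1 θ))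
      (Finset.mem_univ ℓ))

lemma isSubPmf_belief (hnet : IsWeakNetwork net a) (hL : ∀ k θ, IsPmf fun ζ : Z k => L k ζ θ)
    {μ₀ : V → Θ → ℝ} (hμ₀ : ∀ k, IsPmf (μ₀ k)) (x : ℕ → ∀ k, Z k) (i : ℕ) (k : V) :
    IsSubPmf (belief a L μ₀ x i k) := by
  induction i generalizing k with
  | zero => exact (hμ₀ k).isSubPmf
  | succ i ih =>
    rw [belief_succ]
    exact isSubPmf_diffuse hnet hL ih k

omit [Fintype V] [Fintype Θ] [∀ k, Fintype (Z k)] in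
lemma trueState_inl {θS : Fin S → Θ} {θR : Fin R → Θ} {k : V} {s : Fin S}
    (h : net k = Sum.inl s) : trueState net θS θR k = θS s := by
  simp [trueState, h]

omit [Fintype V] [Fintype Θ] [∀ k, Fintype (Z k)] in
lemma trueState_inr {θS : Fin S → Θ} {θR : Fin R → Θ} {k : V} {r : Fin R}
    (h : net k = Sum.inr r) : trueState net θS θR k = θR r := by
  simp [trueState, h]

/-- After finitely many steps all agents of a sending sub-network hold genuine beliefs that put
positive mass on their true state. -/
lemma exists_belief_pos (hnet : IsWeakNetwork net a) (hL : ∀ k θ, IsPmf fun ζ : Z k => L k ζ θ)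
    {μ₀ : V → Θ → ℝ} (hμ₀ : ∀ k, IsPmf (μ₀ k)) {θS : Fin S → Θ} {θR : Fin R → Θ} {s : Fin S}
    (hprior : ∃ k, net k = Sum.inl s ∧ 0 < μ₀ k (θS s)) :
    ∃ N, ∀ x, IsAdmissible L (trueState net θS θR) x → ∀ i, N ≤ i → ∀ k, net k = Sum.inl s →
      0 < belief a L μ₀ x i k (θS s) ∧ IsPmf (belief a L μ₀ x i k) := by
  have hstep : ∀ x, IsAdmissible L (trueState net θS θR) x → ∀ i ℓ k, net ℓ = Sum.inl s →
      0 < a ℓ k → 0 < belief a L μ₀ x i ℓ (θS s) → 0 < belief a L μ₀ x (i + 1) k (θS s) := by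
    intro x hx i ℓ k hℓ ha hpos
    have hz := hx i ℓ
    rw [trueState_inl hℓ] at hz
    rw [belief_succ]
    exact (mul_pos ha (mul_pos hz hpos)).trans_le
      (mul_le_diffuse hnet hL (isSubPmf_belief hnet hL hμ₀ x i) hz)
  obtain ⟨hconn, c, hc, hloop⟩ := hnet.sending_connected s
  obtain ⟨k₀, hk₀, hprior⟩ := hprior
  have h1 : ∃ m, ∀ x, IsAdmissible L (trueState net θS θR) x → 0 < belief a L μ₀ x m c (θS s) := by
    have h := hconn k₀ hk₀ c hc
    clear hloop hc
    induction h with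
    | refl => exact ⟨0, fun x _ => hprior⟩
    | tail _ hyz ih =>
      obtain ⟨m, hm⟩ := ih
      exact ⟨m + 1, fun x hx => hstep x hx m _ _ hyz.1 hyz.2.2 (hm x hx)⟩
  have h2 : ∀ k, ∃ N, net k = Sum.inl s → ∀ x, IsAdmissible L (trueState net θS θR) x →
      ∀ i, N ≤ i → 0 < belief a L μ₀ x i k (θS s) := by
    intro k
    by_cases hk : net k = Sum.inl s
    swap
    · exact ⟨0, fun h => absurd h hk⟩
    have h := hconn c hc k hk
    clear hk
    induction h with
    | refl =>
      obtain ⟨m, hm⟩ := h1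
      refine ⟨m, fun _ x hx i hi => ?_⟩
      induction i, hi using Nat.le_induction with
      | base => exact hm x hx
      | succ i _ ih => exact hstep x hx i c c hc hloop ih
    | tail _ hyz ih =>
      obtain ⟨N, hN⟩ := ih
      refine ⟨N + 1, fun _ x hx i hi => ?_⟩
      obtain ⟨j, rfl⟩ : ∃ j, i = j + 1 := ⟨i - 1, by omega⟩
      exact hstep x hx j _ _ hyz.1 hyz.2.2 (hN hyz.1 x hx j (by omega))
  choose N hN using h2
  have hle : ∀ k, N k ≤ Finset.univ.sup N := fun k => Finset.le_sup (Finset.mem_univ k)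
  refine ⟨Finset.univ.sup N + 1, fun x hx i hi k hk =>
    ⟨hN k hk x hx i ((hle k).trans (by omega)), ?_⟩⟩
  obtain ⟨j, rfl⟩ : ∃ j, i = j + 1 := ⟨i - 1, by omega⟩
  rw [belief_succ]
  refine isPmf_diffuse hnet hL (isSubPmf_belief hnet hL hμ₀ x j) (θ := θS s)
    (fun ℓ hℓ => hN ℓ hℓ x hx j ((hle ℓ).trans (by omega))) (fun ℓ hℓ => ?_) hk
  have := hx j ℓ
  rwa [trueState_inl hℓ] at this

lemma IsWeakNetwork.exists_isPerronWeight (hnet : IsWeakNetwork net a) (s : Fin S) :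
    ∃ y, IsPerronWeight net a s y := by
  obtain ⟨y, h1, h2, h3⟩ := hnet.exists_perron s
  exact ⟨y, h1, h2, h3⟩

lemma IsPerronWeight.nonneg {s : Fin S} {y : V → ℝ} (hy : IsPerronWeight net a s y) (k : V) :
    0 ≤ y k := by
  by_cases h : net k = Sum.inl s
  · exact (hy.pos k h).le
  · exact (hy.eq_zero k h).ge

lemma IsPerronWeight.sum_congr_le {s : Fin S} {y : V → ℝ} (hy : IsPerronWeight net a s y)
    {f g : V → ℝ} (h : ∀ k, net k = Sum.inl s → f k ≤ g k) : ∑ k, y k * f k ≤ ∑ k, y k * g k := by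
  refine Finset.sum_le_sum fun k _ => ?_
  by_cases hk : net k = Sum.inl s
  · exact mul_le_mul_of_nonneg_left (h k hk) (hy.nonneg k)
  · rw [hy.eq_zero k hk, zero_mul, zero_mul]

lemma IsPerronWeight.mul_le_sum {s : Fin S} {y : V → ℝ} (hy : IsPerronWeight net a s y)
    {f : V → ℝ} (h : ∀ k, net k = Sum.inl s → 0 ≤ f k) (k : V) : y k * f k ≤ ∑ k, y k * f k := by
  refine Finset.single_le_sum (f := fun k => y k * f k) (fun j _ => ?_) (Finset.mem_univ k)
  by_cases hj : net j = Sum.inl s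
  · exact mul_nonneg (hy.nonneg j) (h j hj)
  · rw [hy.eq_zero j hj, zero_mul]

lemma IsPerronWeight.potential_nonneg {s : Fin S} {y : V → ℝ} (hy : IsPerronWeight net a s y)
    (hμ : ∀ k, IsSubPmf (μ k)) {θ : Θ} (hpos : ∀ k, net k = Sum.inl s → 0 < μ k θ) :
    0 ≤ potential y θ μ := by
  have := hy.sum_congr_le (f := fun _ => 0) (g := fun k => surprise (μ k θ))
    fun k hk => surprise_nonneg (hpos k hk) ((hμ k).le_one θ)
  simpa [potential] using this

lemma IsPerronWeight.potential_pos {s : Fin S} {y : V → ℝ} (hy : IsPerronWeight net a s y)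
    (hμ : ∀ k, IsSubPmf (μ k)) {θ : Θ} (hpos : ∀ k, net k = Sum.inl s → 0 < μ k θ) {k : V}
    (hk : net k = Sum.inl s) (h1 : μ k θ < 1) : 0 < potential y θ μ :=
  (mul_pos (hy.pos k hk) (surprise_pos (hpos k hk) h1)).trans_le
    (hy.mul_le_sum (f := fun k => surprise (μ k θ))
      (fun k hk => surprise_nonneg (hpos k hk) ((hμ k).le_one θ)) k)

/-- Combining the beliefs does not increase the potential. -/
lemma IsPerronWeight.potential_diffuse_le {s : Fin S} {y : V → ℝ} (hy : IsPerronWeight net a s y)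
    (hnet : IsWeakNetwork net a) (hL : ∀ k θ, IsPmf fun ζ : Z k => L k ζ θ)
    (hμ : ∀ k, IsSubPmf (μ k)) {θ : Θ} (hpos : ∀ k, net k = Sum.inl s → 0 < μ k θ)
    (hz : ∀ ℓ, net ℓ = Sum.inl s → 0 < L ℓ (z ℓ) θ) :
    potential y θ (diffuse a L μ z) ≤ ∑ ℓ, y ℓ * surprise (posterior (L ℓ) (μ ℓ) (z ℓ) θ) := by
  calc potential y θ (diffuse a L μ z)
      ≤ ∑ k, y k * ∑ ℓ, a ℓ k * surprise (posterior (L ℓ) (μ ℓ) (z ℓ) θ) := by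
        refine hy.sum_congr_le fun k hk => ?_
        have h0 : ∀ ℓ ∈ Finset.univ, ℓ ∉ Finset.univ.filter (fun ℓ => net ℓ = Sum.inl s) →
            a ℓ k = 0 := fun ℓ _ h =>
          hnet.sending_closed ℓ k s hk fun h' => h (by simp [h'])
        have hsum : ∀ f : V → ℝ, ∑ ℓ, a ℓ k * f ℓ =
            ∑ ℓ ∈ Finset.univ.filter (fun ℓ => net ℓ = Sum.inl s), a ℓ k * f ℓ := fun f =>
          (Finset.sum_subset (Finset.filter_subset _ _) fun ℓ hℓ h => by
            rw [h0 ℓ hℓ h, zero_mul]).symm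
        rw [diffuse, hsum, hsum]
        refine surprise_sum_le _ (fun ℓ _ => hnet.nonneg ℓ k) ?_ fun ℓ hℓ => ?_
        · have := hsum fun _ => 1
          simpa only [mul_one, hnet.sum_eq_one] using this.symm
        · have hℓ' : net ℓ = Sum.inl s := by simpa using hℓ
          exact posterior_pos (hL ℓ) (hμ ℓ) (hpos ℓ hℓ') (hz ℓ hℓ')
    _ = ∑ ℓ, y ℓ * surprise (posterior (L ℓ) (μ ℓ) (z ℓ) θ) := by
        simp only [Finset.mul_sum]
        rw [Finset.sum_comm]
        refine Finset.sum_congr rfl fun ℓ _ => ?_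
        rw [← hy.fixed ℓ, Finset.sum_mul]
        exact Finset.sum_congr rfl fun k _ => by ring

lemma IsPerronWeight.sum_surprise_posterior_nonneg {s : Fin S} {y : V → ℝ}
    (hy : IsPerronWeight net a s y) (hL : ∀ k θ, IsPmf fun ζ : Z k => L k ζ θ)
    (hμ : ∀ k, IsSubPmf (μ k)) {θ : Θ} (hpos : ∀ k, net k = Sum.inl s → 0 < μ k θ)
    (hz : ∀ ℓ, net ℓ = Sum.inl s → 0 < L ℓ (z ℓ) θ) :
    0 ≤ ∑ ℓ, y ℓ * surprise (posterior (L ℓ) (μ ℓ) (z ℓ) θ) := by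
  have := hy.sum_congr_le (f := fun _ => 0)
    (g := fun ℓ => surprise (posterior (L ℓ) (μ ℓ) (z ℓ) θ)) fun ℓ hℓ =>
      surprise_nonneg (posterior_pos (hL ℓ) (hμ ℓ) (hpos ℓ hℓ) (hz ℓ hℓ))
        ((isSubPmf_posterior (hL ℓ) (hμ ℓ) (z ℓ)).le_one θ)
  simpa using this

lemma IsPerronWeight.sum_surprise_posterior_le {s : Fin S} {y : V → ℝ}
    (hy : IsPerronWeight net a s y) (hL : ∀ k θ, IsPmf fun ζ : Z k => L k ζ θ)
    (hμ : ∀ k, IsSubPmf (μ k)) {θ : Θ} (hpos : ∀ k, net k = Sum.inl s → 0 < μ k θ)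
    {δ : ℝ} (hδ : 0 < δ) (hδ1 : δ ≤ 1) (hz : ∀ ℓ, net ℓ = Sum.inl s → δ ≤ L ℓ (z ℓ) θ) :
    ∑ ℓ, y ℓ * surprise (posterior (L ℓ) (μ ℓ) (z ℓ) θ) ≤ 1 / δ * potential y θ μ := by
  refine (hy.sum_congr_le (g := fun ℓ => 1 / δ * surprise (μ ℓ θ)) fun ℓ hℓ =>
    surprise_posterior_le (hL ℓ) (hμ ℓ) (hpos ℓ hℓ) hδ hδ1 (hz ℓ hℓ)).trans_eq ?_
  rw [potential, Finset.mul_sum]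
  exact Finset.sum_congr rfl fun ℓ _ => by ring

/-- The tangent line inequality for concave powers. -/
lemma rpow_le_tangent {A B q : ℝ} (hA : 0 ≤ A) (hB : 0 ≤ B) (hAB : A = 0 → B = 0) (hq : 0 < q)
    (hq1 : q ≤ 1) : B ^ q ≤ A ^ q + q * A ^ (q - 1) * (B - A) := by
  rcases hA.eq_or_lt with h | h
  · rw [← h, hAB h.symm, Real.zero_rpow hq.ne']
    simp
  · have h1 := rpow_one_add_le_one_add_mul_self (s := B / A - 1) (p := q)
      (by linarith [div_nonneg hB hA]) hq.le hq1
    rw [add_sub_cancel, Real.div_rpow hB hA, div_le_iff₀ (Real.rpow_pos_of_pos h q)] at h1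
    refine h1.trans_eq ?_
    rw [Real.rpow_sub_one h.ne']
    field_simp

lemma surprise_le {x : ℝ} (hx : 1 / 4 ≤ x) (hx1 : x ≤ 1) : surprise x ≤ 2 * (1 - x) := by
  have h0 : 0 < x := by linarith
  have h1 : √x ≤ 1 := Real.sqrt_le_one.mpr hx1
  have h2 : 1 / 2 ≤ √x := by
    rw [Real.le_sqrt' (by norm_num)]
    linarith
  have h3 := Real.sq_sqrt h0.le
  have h4 : (√x)⁻¹ ≤ 1 + 2 * (1 - √x) := by
    rw [inv_le_iff_one_le_mul₀ (by linarith)]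
    nlinarith
  unfold surprise
  nlinarith

/-- Near full belief the potential is at most proportional to the missing mass. -/
lemma IsPerronWeight.rpow_residual_le {s : Fin S} {y : V → ℝ} (hy : IsPerronWeight net a s y)
    (hμ : ∀ k, net k = Sum.inl s → IsPmf (μ k)) (hμ' : ∀ k, IsSubPmf (μ k)) {θ₀ : Θ}
    (hpos : ∀ k, net k = Sum.inl s → 0 < μ k θ₀) {q : ℝ} (hq : 0 < q) (hq1 : q ≤ 1) {k : V}
    (hk : net k = Sum.inl s) {M : ℝ} (hM0 : 0 ≤ M)
    (hM : ∀ k, net k = Sum.inl s → ∀ θ, θ ≠ θ₀ → μ k θ ^ 2 ≤ M) :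
    residual {θ₀} (μ k) ^ (1 + q) ≤
      ((2 * ∑ k, y k) ^ (1 - q) + 2) * (Fintype.card V * Fintype.card Θ) ^ 2 *
        (potential y θ₀ μ ^ (q - 1) * M + M) := by
  classical
  have hres : ∀ j, 0 ≤ residual {θ₀} (μ j) := fun j => residual_nonneg (hμ' j) _
  set I := Finset.univ.filter fun j => net j = Sum.inl s with hI
  have hmem : ∀ j, j ∈ I ↔ net j = Sum.inl s := fun j => by simp [hI]
  set r := ∑ j ∈ I, residual {θ₀} (μ j) with hr
  set m : ℝ := Fintype.card V * Fintype.card Θ with hm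
  have hY0 := hy.potential_nonneg hμ' hpos
  have hB0 : 0 ≤ ∑ k, y k := Finset.sum_nonneg fun j _ => hy.nonneg j
  have hle : ∀ j, net j = Sum.inl s → residual {θ₀} (μ j) ≤ r := fun j hj =>
    Finset.single_le_sum (fun i _ => hres i) ((hmem j).mpr hj)
  have hrM : r ≤ m * √M := by
    have h1 : ∀ j ∈ I, residual {θ₀} (μ j) ≤ Fintype.card Θ * √M := by
      intro j hj
      have e : residual {θ₀} (μ j) = ∑ θ ∈ Finset.univ.erase θ₀, μ j θ := by
        rw [residual, Finset.sum_singleton, ← (hμ j ((hmem j).mp hj)).2,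
          ← Finset.sum_erase_add _ _ (Finset.mem_univ θ₀)]
        ring
      rw [e]
      refine (Finset.sum_le_card_nsmul _ _ (√M) fun θ hθ => ?_).trans ?_
      · exact Real.le_sqrt_of_sq_le (hM j ((hmem j).mp hj) θ (Finset.ne_of_mem_erase hθ))
      · rw [nsmul_eq_mul]
        gcongr
        exact Finset.card_le_univ _
    refine (Finset.sum_le_card_nsmul _ _ _ h1).trans ?_
    rw [nsmul_eq_mul, hm, mul_assoc]
    gcongr
    exact Finset.card_le_univ _
  have hr0 : 0 ≤ r := Finset.sum_nonneg fun j _ => hres j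
  have hr2 : r ^ 2 ≤ m ^ 2 * M := by
    calc r ^ 2 ≤ (m * √M) ^ 2 := by gcongr
      _ = m ^ 2 * M := by rw [mul_pow, Real.sq_sqrt hM0]
  set Y := potential y θ₀ μ with hY
  set B := (2 * ∑ k, y k) ^ (1 - q) with hB
  have hBq : 0 ≤ B := Real.rpow_nonneg (by positivity) _
  have hYq : 0 ≤ Y ^ (q - 1) := Real.rpow_nonneg hY0 _
  rcases hr0.eq_or_lt with h0 | h0
  · have : residual {θ₀} (μ k) = 0 := le_antisymm (h0 ▸ hle k hk) (hres k)
    rw [this, Real.zero_rpow (by linarith)]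
    positivity
  · have hrq : r ^ (q - 1) ≤ B * Y ^ (q - 1) + 2 := by
      rcases le_or_gt r (1 / 2) with h | h
      · have hYr : Y ≤ (2 * ∑ k, y k) * r := by
          have := hy.sum_congr_le (f := fun j => surprise (μ j θ₀)) (g := fun _ => 2 * r) ?_
          · rw [← Finset.sum_mul] at this
            calc Y ≤ (∑ k, y k) * (2 * r) := this
              _ = _ := by ring
          · intro j hj
            have h1 := hle j hj
            rw [residual, Finset.sum_singleton] at h1
            exact (surprise_le (by linarith) ((hμ' j).le_one θ₀)).trans (by linarith)
        have hYpos : 0 < Y := by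
          obtain ⟨j, hj, hjr⟩ : ∃ j ∈ I, 0 < residual {θ₀} (μ j) := by
            by_contra! hn
            exact absurd (Finset.sum_nonpos hn) (not_le.mpr h0)
          rw [residual, Finset.sum_singleton] at hjr
          exact hy.potential_pos hμ' hpos ((hmem j).mp hj) (by linarith)
        have hBpos : 0 < 2 * ∑ k, y k := by
          by_contra! hn
          exact absurd (hYr.trans (mul_nonpos_of_nonpos_of_nonneg hn hr0)) (not_le.mpr hYpos)
        have h1 : ((2 * ∑ k, y k) * r) ^ (q - 1) ≤ Y ^ (q - 1) :=
          Real.rpow_le_rpow_of_nonpos hYpos hYr (by linarith)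
        rw [Real.mul_rpow hBpos.le hr0] at h1
        have h2 : B * (2 * ∑ k, y k) ^ (q - 1) = 1 := by
          rw [hB, ← Real.rpow_add hBpos]
          simp
        calc r ^ (q - 1) = B * ((2 * ∑ k, y k) ^ (q - 1) * r ^ (q - 1)) := by
              rw [← mul_assoc, h2, one_mul]
          _ ≤ B * Y ^ (q - 1) := by gcongr
          _ ≤ B * Y ^ (q - 1) + 2 := by linarith
      · have h1 : r ^ (q - 1) ≤ (1 / 2) ^ (q - 1) :=
          Real.rpow_le_rpow_of_nonpos (by norm_num) h.le (by linarith)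
        have h2 : (1 / 2 : ℝ) ^ (q - 1) ≤ (1 / 2) ^ (-1 : ℝ) :=
          Real.rpow_le_rpow_of_exponent_ge (by norm_num) (by norm_num) (by linarith)
        have h3 : (1 / 2 : ℝ) ^ (-1 : ℝ) = 2 := by
          rw [Real.rpow_neg_one]
          norm_num
        have : 0 ≤ B * Y ^ (q - 1) := by positivity
        linarith
    calc residual {θ₀} (μ k) ^ (1 + q) ≤ r ^ (1 + q) := by
          gcongr
          · exact hres k
          · exact hle k hk
      _ = r ^ (q - 1) * r ^ 2 := by
          rw [← Real.rpow_natCast, ← Real.rpow_add h0]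
          congr 1
          push_cast
          ring
      _ ≤ (B * Y ^ (q - 1) + 2) * (m ^ 2 * M) := by gcongr
      _ ≤ (B + 2) * m ^ 2 * (Y ^ (q - 1) * M + M) := by
          have h1 : 0 ≤ m ^ 2 * M := by positivity
          have h2 : B * Y ^ (q - 1) + 2 ≤ (B + 2) * (Y ^ (q - 1) + 1) := by nlinarith
          calc (B * Y ^ (q - 1) + 2) * (m ^ 2 * M)
              ≤ ((B + 2) * (Y ^ (q - 1) + 1)) * (m ^ 2 * M) := by gcongr
            _ = _ := by ring

end Step

/-! ### Learning in the sending sub-networks -/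

/-- The beliefs at time `i` along the signal process `ξ`. -/
abbrev randomBelief {V Θ Ω : Type*} {Z : V → Type*} [Fintype V] [Fintype Θ] (a : Matrix V V ℝ)
    (L : ∀ k, Z k → Θ → ℝ) (μ₀ : V → Θ → ℝ) (ξ : ℕ → Ω → ∀ k, Z k) (i : ℕ) (ω : Ω) :
    V → Θ → ℝ :=
  belief a L μ₀ (fun j => ξ j ω) i

/-- The expected decrease of the potential of agent `ℓ` in one Bayesian update. -/
def potentialDrop {V Θ : Type*} {Z : V → Type*} [Fintype Θ] [∀ k, Fintype (Z k)]
    (L : ∀ k, Z k → Θ → ℝ) (θ : Θ) (μ : V → Θ → ℝ) (ℓ : V) : ℝ :=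
  surprise (μ ℓ θ) - ∑ ζ, L ℓ ζ θ * surprise (posterior (L ℓ) (μ ℓ) ζ θ)

lemma summable_of_le_sub {b g : ℕ → ℝ} (hb : ∀ i, 0 ≤ b i) (hg : ∀ i, 0 ≤ g i)
    (h : ∀ i, b (i + 1) ≤ b i - g i) : Summable g := by
  refine summable_of_sum_range_le (c := b 0) hg fun n => ?_
  have : ∑ i ∈ Finset.range n, g i ≤ b 0 - b n := by
    induction n with
    | zero => simp
    | succ n ih =>
      rw [Finset.sum_range_succ]
      linarith [h n]
  linarith [hb n]

section Sending

variable {V Θ Ω : Type*} {Z : V → Type*} [Fintype V] [Fintype Θ] [∀ k, Fintype (Z k)]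
  [∀ k, MeasurableSpace (Z k)] [∀ k, DiscreteMeasurableSpace (Z k)]
  [MeasurableSpace Ω] {P : Measure Ω} [IsProbabilityMeasure P]
  {S R : ℕ} {net : V → Fin S ⊕ Fin R} {a : Matrix V V ℝ}
  {L : ∀ k, Z k → Θ → ℝ} {θS : Fin S → Θ} {θR : Fin R → Θ}
  {ξ : ℕ → Ω → ∀ k, Z k} {μ₀ : V → Θ → ℝ} {s : Fin S} {y : V → ℝ} {N : ℕ}

lemma integral_rpow_potential_le (hnet : IsWeakNetwork net a)
    (hL : ∀ k θ, IsPmf fun ζ : Z k => L k ζ θ)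
    (hξ : IsSignalProcess P L (trueState net θS θR) ξ) (hμ₀ : ∀ k, IsPmf (μ₀ k))
    (hy : IsPerronWeight net a s y)
    (hN : ∀ x, IsAdmissible L (trueState net θS θR) x → ∀ i, N ≤ i → ∀ k, net k = Sum.inl s →
      0 < belief a L μ₀ x i k (θS s) ∧ IsPmf (belief a L μ₀ x i k))
    {δ : ℝ} (hδ : 0 < δ) (hδ1 : δ ≤ 1)
    (hmin : ∀ k ζ, 0 < L k ζ (trueState net θS θR k) → δ ≤ L k ζ (trueState net θS θR k))
    {q : ℝ} (hq : 0 < q) (hq1 : q ≤ 1) {i : ℕ} (hi : N ≤ i) :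
    ∫ ω, potential y (θS s) (randomBelief a L μ₀ ξ (i + 1) ω) ^ q ∂P ≤
      ∫ ω, potential y (θS s) (randomBelief a L μ₀ ξ i ω) ^ q ∂P -
        ∫ ω, q * potential y (θS s) (randomBelief a L μ₀ ξ i ω) ^ (q - 1) *
          ∑ ℓ, y ℓ * potentialDrop L (θS s) (randomBelief a L μ₀ ξ i ω) ℓ ∂P := by
  set F : ∀ ℓ, (V → Θ → ℝ) → Z ℓ → ℝ := fun ℓ μ z =>
    q * potential y (θS s) μ ^ (q - 1) *
      (y ℓ * (surprise (posterior (L ℓ) (μ ℓ) z (θS s)) - surprise (μ ℓ (θS s)))) with hF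
  have hFint : ∀ ℓ, Integrable
      (fun ω => F ℓ (randomBelief a L μ₀ ξ i ω) (ξ (i + 1) ω ℓ)) P := fun ℓ =>
    hξ.integrable_belief_signal i ℓ (F ℓ)
  have hYint : ∀ j, Integrable
      (fun ω => potential y (θS s) (randomBelief a L μ₀ ξ j ω) ^ q) P := fun j =>
    hξ.integrable_belief j fun μ => potential y (θS s) μ ^ q
  have hstep : ∀ᵐ ω ∂P, potential y (θS s) (randomBelief a L μ₀ ξ (i + 1) ω) ^ q ≤
      potential y (θS s) (randomBelief a L μ₀ ξ i ω) ^ q +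
        ∑ ℓ, F ℓ (randomBelief a L μ₀ ξ i ω) (ξ (i + 1) ω ℓ) := by
    filter_upwards [hξ.ae_isAdmissible hL] with ω hω
    have hsub := isSubPmf_belief hnet hL hμ₀ (fun j => ξ j ω) i
    have hpos := fun k hk => (hN _ hω i hi k hk).1
    have hz : ∀ ℓ, net ℓ = Sum.inl s → 0 < L ℓ (ξ (i + 1) ω ℓ) (θS s) := fun ℓ hℓ => by
      have := hω i ℓ
      rwa [trueState_inl hℓ] at this
    have hzδ : ∀ ℓ, net ℓ = Sum.inl s → δ ≤ L ℓ (ξ (i + 1) ω ℓ) (θS s) := fun ℓ hℓ => by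
      have := hmin ℓ _ (hω i ℓ)
      rwa [trueState_inl hℓ] at this
    have hY0 := hy.potential_nonneg hsub hpos
    have hY1 := hy.potential_nonneg
      (isSubPmf_belief hnet hL hμ₀ (fun j => ξ j ω) (i + 1))
      fun k hk => (hN _ hω (i + 1) (by omega) k hk).1
    have hle := hy.potential_diffuse_le hnet hL hsub hpos hz
    have hpost := hy.sum_surprise_posterior_nonneg hL hsub hpos hz
    have hK := hy.sum_surprise_posterior_le hL hsub hpos hδ hδ1 hzδ
    refine (Real.rpow_le_rpow hY1 hle hq.le).trans
      ((rpow_le_tangent hY0 hpost (fun h => le_antisymm ?_ hpost) hq hq1).trans_eq ?_)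
    · rw [h, mul_zero] at hK
      exact hK
    · simp only [hF]
      rw [← Finset.mul_sum]
      congr 2
      rw [potential, ← Finset.sum_sub_distrib]
      exact Finset.sum_congr rfl fun ℓ _ => by ring
  refine (integral_mono_ae (hYint (i + 1))
    ((hYint i).add (integrable_finsetSum _ fun ℓ _ => hFint ℓ)) hstep).trans_eq ?_
  simp only [Pi.add_apply]
  rw [integral_add (hYint i) (integrable_finsetSum _ fun ℓ _ => hFint ℓ),
    integral_finsetSum _ fun ℓ _ => hFint ℓ, sub_eq_add_neg]
  congr 1
  have hD : ∀ ℓ, Integrable (fun ω => q * potential y (θS s) (randomBelief a L μ₀ ξ i ω) ^ (q - 1) *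
      (y ℓ * potentialDrop L (θS s) (randomBelief a L μ₀ ξ i ω) ℓ)) P := fun ℓ =>
    hξ.integrable_belief i fun μ => q * potential y (θS s) μ ^ (q - 1) *
      (y ℓ * potentialDrop L (θS s) μ ℓ)
  simp only [Finset.mul_sum]
  rw [integral_finsetSum _ fun ℓ _ => hD ℓ, ← Finset.sum_neg_distrib]
  refine Finset.sum_congr rfl fun ℓ _ => ?_
  rw [hξ.integral_belief_signal i ℓ (F ℓ), ← integral_neg]
  congr 1
  ext ω
  by_cases hℓ : net ℓ = Sum.inl s
  · simp only [hF, trueState_inl hℓ, potentialDrop]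
    set μ := belief a L μ₀ (fun j => ξ j ω) i
    set c := q * potential y (θS s) μ ^ (q - 1)
    have : ∀ ζ, L ℓ ζ (θS s) *
        (c * (y ℓ * (surprise (posterior (L ℓ) (μ ℓ) ζ (θS s)) - surprise (μ ℓ (θS s))))) =
        c * y ℓ * (L ℓ ζ (θS s) * surprise (posterior (L ℓ) (μ ℓ) ζ (θS s))) -
        c * y ℓ * surprise (μ ℓ (θS s)) * L ℓ ζ (θS s) := fun ζ => by ring
    rw [Finset.sum_congr rfl fun ζ _ => this ζ, Finset.sum_sub_distrib, ← Finset.mul_sum,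
      ← Finset.mul_sum, (hL ℓ (θS s)).2]
    ring
  · simp [hF, hy.eq_zero ℓ hℓ]

omit [Fintype V] [∀ k, MeasurableSpace (Z k)] [∀ k, DiscreteMeasurableSpace (Z k)] in
lemma le_potentialDrop (hL : ∀ k θ, IsPmf fun ζ : Z k => L k ζ θ) {μ : V → Θ → ℝ}
    (hμ : ∀ k, IsSubPmf (μ k)) {θ₀ θ : Θ} {ℓ : V} (hpos : 0 < μ ℓ θ₀) {ζ₀ : Z ℓ}
    (hζ₀ : IsPrevailing L θ₀ ℓ ζ₀) :
    (L ℓ ζ₀ θ₀ - L ℓ ζ₀ θ) ^ 2 / 8 * μ ℓ θ ^ 2 ≤ potentialDrop L θ₀ μ ℓ := by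
  have h1 := sum_mul_surprise_posterior_le (hL ℓ) (hμ ℓ) hpos
  have h2 := prevailing_sq_le (hL ℓ) (hμ ℓ) (θ := θ) (fun θ' => by
    by_cases h : θ' ∈ indistinguishable L θ₀ ℓ
    · exact (h ζ₀).le
    · exact (hζ₀ θ' h).le)
  unfold potentialDrop
  linarith

/-- States that an agent distinguishes from the true one lose their mass at a summable rate. -/
lemma summable_integral_of_distinguishable (hnet : IsWeakNetwork net a)
    (hL : ∀ k θ, IsPmf fun ζ : Z k => L k ζ θ)
    (hξ : IsSignalProcess P L (trueState net θS θR) ξ) (hμ₀ : ∀ k, IsPmf (μ₀ k))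
    (hy : IsPerronWeight net a s y)
    (hN : ∀ x, IsAdmissible L (trueState net θS θR) x → ∀ i, N ≤ i → ∀ k, net k = Sum.inl s →
      0 < belief a L μ₀ x i k (θS s) ∧ IsPmf (belief a L μ₀ x i k))
    {δ : ℝ} (hδ : 0 < δ) (hδ1 : δ ≤ 1)
    (hmin : ∀ k ζ, 0 < L k ζ (trueState net θS θR k) → δ ≤ L k ζ (trueState net θS θR k))
    {q : ℝ} (hq : 0 < q) (hq1 : q ≤ 1)
    (hprevailing : ∀ k, net k = Sum.inl s → ∃ ζ : Z k, IsPrevailing L (θS s) k ζ)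
    {ℓ : V} (hℓ : net ℓ = Sum.inl s) {θ : Θ} (hθ : θ ∉ indistinguishable L (θS s) ℓ) :
    Summable fun i => ∫ ω, potential y (θS s) (randomBelief a L μ₀ ξ (N + i) ω) ^ (q - 1) *
      randomBelief a L μ₀ ξ (N + i) ω ℓ θ ^ 2 ∂P := by
  obtain ⟨ζ₀, hζ₀⟩ := hprevailing ℓ hℓ
  have hgap : 0 < L ℓ ζ₀ (θS s) - L ℓ ζ₀ θ := sub_pos.mpr (hζ₀ θ hθ)
  set c := q * (y ℓ * ((L ℓ ζ₀ (θS s) - L ℓ ζ₀ θ) ^ 2 / 8)) with hc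
  have hyℓ := hy.pos ℓ hℓ
  have hc0 : 0 < c := by positivity
  have hle : ∀ i, ∀ᵐ ω ∂P,
      c * (potential y (θS s) (randomBelief a L μ₀ ξ (N + i) ω) ^ (q - 1) *
        randomBelief a L μ₀ ξ (N + i) ω ℓ θ ^ 2) ≤
      q * potential y (θS s) (randomBelief a L μ₀ ξ (N + i) ω) ^ (q - 1) *
        ∑ ℓ, y ℓ * potentialDrop L (θS s) (randomBelief a L μ₀ ξ (N + i) ω) ℓ := by
    intro i
    filter_upwards [hξ.ae_isAdmissible hL] with ω hω
    have hsub := isSubPmf_belief hnet hL hμ₀ (fun j => ξ j ω) (N + i)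
    have hpos := fun k hk => (hN _ hω (N + i) (by omega) k hk).1
    have hY := Real.rpow_nonneg (hy.potential_nonneg hsub hpos) (q - 1)
    have h1 := le_potentialDrop hL hsub (θ := θ) (hpos ℓ hℓ) hζ₀
    have h2 := hy.mul_le_sum (f := fun ℓ => potentialDrop L (θS s)
      (randomBelief a L μ₀ ξ (N + i) ω) ℓ) (fun k hk => by
        obtain ⟨ζ₁, hζ₁⟩ := hprevailing k hk
        exact (by positivity : (0 : ℝ) ≤ _).trans
          (le_potentialDrop hL hsub (θ := θ) (hpos k hk) hζ₁)) ℓ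
    have h3 := (mul_le_mul_of_nonneg_left h1 hyℓ.le).trans h2
    calc _ = q * potential y (θS s) (randomBelief a L μ₀ ξ (N + i) ω) ^ (q - 1) *
          (y ℓ * ((L ℓ ζ₀ (θS s) - L ℓ ζ₀ θ) ^ 2 / 8 *
            randomBelief a L μ₀ ξ (N + i) ω ℓ θ ^ 2)) := by
          rw [hc]
          ring
      _ ≤ _ := by gcongr
  have h0 : ∀ i, ∀ᵐ ω ∂P,
      0 ≤ potential y (θS s) (randomBelief a L μ₀ ξ (N + i) ω) := by
    intro i
    filter_upwards [hξ.ae_isAdmissible hL] with ω hω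
    exact hy.potential_nonneg (isSubPmf_belief hnet hL hμ₀ _ _)
      fun k hk => (hN _ hω (N + i) (by omega) k hk).1
  have hint : ∀ i, Integrable (fun ω => c *
      (potential y (θS s) (randomBelief a L μ₀ ξ (N + i) ω) ^ (q - 1) *
        randomBelief a L μ₀ ξ (N + i) ω ℓ θ ^ 2)) P := fun i =>
    hξ.integrable_belief (N + i) fun μ => c * (potential y (θS s) μ ^ (q - 1) * μ ℓ θ ^ 2)
  have hint' : ∀ i, Integrable (fun ω =>
      q * potential y (θS s) (randomBelief a L μ₀ ξ (N + i) ω) ^ (q - 1) *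
        ∑ ℓ, y ℓ * potentialDrop L (θS s) (randomBelief a L μ₀ ξ (N + i) ω) ℓ) P := fun i =>
    hξ.integrable_belief (N + i) fun μ => q * potential y (θS s) μ ^ (q - 1) *
      ∑ ℓ, y ℓ * potentialDrop L (θS s) μ ℓ
  have hnn : ∀ i, 0 ≤ ∫ ω, c *
      (potential y (θS s) (randomBelief a L μ₀ ξ (N + i) ω) ^ (q - 1) *
        randomBelief a L μ₀ ξ (N + i) ω ℓ θ ^ 2) ∂P := fun i => by
    refine integral_nonneg_of_ae ?_
    filter_upwards [h0 i] with ω hω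
    have := Real.rpow_nonneg hω (q - 1)
    simp only [Pi.zero_apply]
    positivity
  have hmono := fun i => integral_mono_ae (hint i) (hint' i) (hle i)
  have hsum := summable_of_le_sub
    (b := fun i => ∫ ω, potential y (θS s) (randomBelief a L μ₀ ξ (N + i) ω) ^ q ∂P)
    (fun i => integral_nonneg_of_ae (by
      filter_upwards [h0 i] with ω hω
      exact Real.rpow_nonneg hω q))
    (fun i => (hnn i).trans (hmono i))
    (fun i => integral_rpow_potential_le hnet hL hξ hμ₀ hy hN hδ hδ1 hmin hq hq1
      (Nat.le_add_right N i))
  have := Summable.of_nonneg_of_le hnn hmono hsum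
  simp only [integral_const_mul] at this
  exact (summable_mul_left_iff hc0.ne').mp this

/-- The summable rate is inherited by the agents whose beliefs feed an agent with that rate. -/
lemma summable_integral_of_neighbor (hnet : IsWeakNetwork net a)
    (hL : ∀ k θ, IsPmf fun ζ : Z k => L k ζ θ)
    (hξ : IsSignalProcess P L (trueState net θS θR) ξ) (hμ₀ : ∀ k, IsPmf (μ₀ k))
    (hy : IsPerronWeight net a s y)
    (hN : ∀ x, IsAdmissible L (trueState net θS θR) x → ∀ i, N ≤ i → ∀ k, net k = Sum.inl s →
      0 < belief a L μ₀ x i k (θS s) ∧ IsPmf (belief a L μ₀ x i k))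
    {δ : ℝ} (hδ : 0 < δ) (hδ1 : δ ≤ 1)
    (hmin : ∀ k ζ, 0 < L k ζ (trueState net θS θR k) → δ ≤ L k ζ (trueState net θS θR k))
    {q : ℝ} (hq1 : q ≤ 1) {k k' : V} (hk : net k = Sum.inl s) (hk' : net k' = Sum.inl s)
    (ha : 0 < a k k') {θ : Θ} (hne : θ ≠ θS s) (hθ : θ ∈ indistinguishable L (θS s) k)
    (hsum : Summable fun i =>
      ∫ ω, potential y (θS s) (randomBelief a L μ₀ ξ (N + i) ω) ^ (q - 1) *
        randomBelief a L μ₀ ξ (N + i) ω k' θ ^ 2 ∂P) :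
    Summable fun i => ∫ ω, potential y (θS s) (randomBelief a L μ₀ ξ (N + i) ω) ^ (q - 1) *
      randomBelief a L μ₀ ξ (N + i) ω k θ ^ 2 ∂P := by
  classical
  set c := (1 / δ) ^ (q - 1) * (a k k' * δ) ^ 2 with hc
  have hc0 : 0 < c := by positivity
  have h0 : ∀ i, ∀ᵐ ω ∂P,
      0 ≤ potential y (θS s) (randomBelief a L μ₀ ξ (N + i) ω) := by
    intro i
    filter_upwards [hξ.ae_isAdmissible hL] with ω hω
    exact hy.potential_nonneg (isSubPmf_belief hnet hL hμ₀ _ _)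
      fun k hk => (hN _ hω (N + i) (by omega) k hk).1
  have hle : ∀ i, ∀ᵐ ω ∂P,
      c * (potential y (θS s) (randomBelief a L μ₀ ξ (N + i) ω) ^ (q - 1) *
        randomBelief a L μ₀ ξ (N + i) ω k θ ^ 2) ≤
      potential y (θS s) (randomBelief a L μ₀ ξ (N + (i + 1)) ω) ^ (q - 1) *
        randomBelief a L μ₀ ξ (N + (i + 1)) ω k' θ ^ 2 := by
    intro i
    filter_upwards [hξ.ae_isAdmissible hL] with ω hω
    have hsub := isSubPmf_belief hnet hL hμ₀ (fun j => ξ j ω) (N + i)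
    have hsub' := isSubPmf_belief hnet hL hμ₀ (fun j => ξ j ω) (N + i + 1)
    have hpos := fun k hk => (hN _ hω (N + i) (by omega) k hk).1
    have hpos' := fun k hk => (hN _ hω (N + i + 1) (by omega) k hk).1
    have hz : ∀ ℓ, net ℓ = Sum.inl s → 0 < L ℓ (ξ (N + i + 1) ω ℓ) (θS s) := fun ℓ hℓ => by
      have := hω (N + i) ℓ
      rwa [trueState_inl hℓ] at this
    have hzδ : ∀ ℓ, net ℓ = Sum.inl s → δ ≤ L ℓ (ξ (N + i + 1) ω ℓ) (θS s) := fun ℓ hℓ => by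
      have := hmin ℓ _ (hω (N + i) ℓ)
      rwa [trueState_inl hℓ] at this
    have hY0 := hy.potential_nonneg hsub hpos
    have hY1 := hy.potential_nonneg hsub' hpos'
    have hK := (hy.potential_diffuse_le hnet hL hsub hpos hz).trans
      (hy.sum_surprise_posterior_le hL hsub hpos hδ hδ1 hzδ)
    rw [← belief_succ (x := fun j => ξ j ω)] at hK
    have hm := mul_le_diffuse (k := k') hnet hL hsub (z := ξ (N + i + 1) ω) (ℓ := k) (θ := θ)
      (by rw [hθ]; exact hz k hk)
    rw [← belief_succ (x := fun j => ξ j ω), hθ] at hm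
    rw [← add_assoc]
    unfold randomBelief
    set μ := belief a L μ₀ (fun j => ξ j ω) (N + i)
    set μ' := belief a L μ₀ (fun j => ξ j ω) (N + i + 1)
    have hm' : a k k' * δ * μ k θ ≤ μ' k' θ := by
      refine le_trans ?_ hm
      rw [mul_assoc]
      have := hzδ k hk
      have := (hsub k).1 θ
      gcongr
    have hμ0 := (hsub k).1 θ
    rcases hY1.eq_or_lt with h | h
    · have h1 : μ' k' (θS s) = 1 := by
        refine le_antisymm ((hsub' k').le_one _) (not_lt.mp fun hlt => ?_)
        exact (hy.potential_pos hsub' hpos' hk' hlt).ne h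
      have h2 : μ' k' θ ≤ 0 := by
        have := (hsub' k').sum_le_one {θ, θS s}
        rw [Finset.sum_pair hne] at this
        linarith
      have h3 : μ k θ = 0 := by
        refine le_antisymm (not_lt.mp fun hlt => ?_) hμ0
        have : 0 < a k k' * δ * μ k θ := by positivity
        linarith
      rw [h3]
      have := Real.rpow_nonneg hY1 (q - 1)
      simp only [ne_eq, OfNat.ofNat_ne_zero, not_false_eq_true, zero_pow, mul_zero]
      positivity
    · have h1 : (1 / δ * potential y (θS s) μ) ^ (q - 1) ≤ potential y (θS s) μ' ^ (q - 1) :=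
        Real.rpow_le_rpow_of_nonpos h hK (by linarith)
      rw [Real.mul_rpow (by positivity) hY0] at h1
      calc c * (potential y (θS s) μ ^ (q - 1) * μ k θ ^ 2)
          = ((1 / δ) ^ (q - 1) * potential y (θS s) μ ^ (q - 1)) * (a k k' * δ * μ k θ) ^ 2 := by
            rw [hc]
            ring
        _ ≤ potential y (θS s) μ' ^ (q - 1) * μ' k' θ ^ 2 := by gcongr
  have hint : ∀ i, Integrable (fun ω => c *
      (potential y (θS s) (randomBelief a L μ₀ ξ (N + i) ω) ^ (q - 1) *
        randomBelief a L μ₀ ξ (N + i) ω k θ ^ 2)) P := fun i =>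
    hξ.integrable_belief (N + i) fun μ => c * (potential y (θS s) μ ^ (q - 1) * μ k θ ^ 2)
  have hint' : ∀ i, Integrable (fun ω =>
      potential y (θS s) (randomBelief a L μ₀ ξ (N + (i + 1)) ω) ^ (q - 1) *
        randomBelief a L μ₀ ξ (N + (i + 1)) ω k' θ ^ 2) P := fun i =>
    hξ.integrable_belief (N + (i + 1)) fun μ => potential y (θS s) μ ^ (q - 1) * μ k' θ ^ 2
  have hnn : ∀ i, 0 ≤ ∫ ω, c *
      (potential y (θS s) (randomBelief a L μ₀ ξ (N + i) ω) ^ (q - 1) *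
        randomBelief a L μ₀ ξ (N + i) ω k θ ^ 2) ∂P := fun i => by
    refine integral_nonneg_of_ae ?_
    filter_upwards [h0 i] with ω hω
    have := Real.rpow_nonneg hω (q - 1)
    simp only [Pi.zero_apply]
    positivity
  have := Summable.of_nonneg_of_le hnn
    (fun i => integral_mono_ae (hint i) (hint' i) (hle i)) ((summable_nat_add_iff 1).mpr hsum)
  simp only [integral_const_mul] at this
  exact (summable_mul_left_iff hc0.ne').mp this

lemma summable_integral_of_ne (hnet : IsWeakNetwork net a)
    (hL : ∀ k θ, IsPmf fun ζ : Z k => L k ζ θ)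
    (hξ : IsSignalProcess P L (trueState net θS θR) ξ) (hμ₀ : ∀ k, IsPmf (μ₀ k))
    (hy : IsPerronWeight net a s y)
    (hN : ∀ x, IsAdmissible L (trueState net θS θR) x → ∀ i, N ≤ i → ∀ k, net k = Sum.inl s →
      0 < belief a L μ₀ x i k (θS s) ∧ IsPmf (belief a L μ₀ x i k))
    {δ : ℝ} (hδ : 0 < δ) (hδ1 : δ ≤ 1)
    (hmin : ∀ k ζ, 0 < L k ζ (trueState net θS θR k) → δ ≤ L k ζ (trueState net θS θR k))
    (hprevailing : ∀ k, net k = Sum.inl s → ∃ ζ : Z k, IsPrevailing L (θS s) k ζ)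
    (hident : ⋂ k ∈ {k | net k = Sum.inl s}, indistinguishable L (θS s) k = {θS s})
    {q : ℝ} (hq : 0 < q) (hq1 : q ≤ 1) {k : V} (hk : net k = Sum.inl s) {θ : Θ}
    (hne : θ ≠ θS s) :
    Summable fun i => ∫ ω, potential y (θS s) (randomBelief a L μ₀ ξ (N + i) ω) ^ (q - 1) *
      randomBelief a L μ₀ ξ (N + i) ω k θ ^ 2 ∂P := by
  obtain ⟨c, hc, hθ⟩ : ∃ c, net c = Sum.inl s ∧ θ ∉ indistinguishable L (θS s) c := by
    by_contra! h
    have : θ ∈ ⋂ k ∈ {k | net k = Sum.inl s}, indistinguishable L (θS s) k := by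
      simpa using h
    rw [hident] at this
    exact hne this
  have hbase := fun {ℓ} (hℓ : net ℓ = Sum.inl s) hθ => summable_integral_of_distinguishable hnet hL
    hξ hμ₀ hy hN hδ hδ1 hmin hq hq1 hprevailing (ℓ := ℓ) hℓ (θ := θ) hθ
  refine ((hnet.sending_connected s).1 k hk c hc).head_induction_on (hbase hc hθ)
    fun {x z} hxz _ ih => ?_
  by_cases h : θ ∈ indistinguishable L (θS s) x
  · exact summable_integral_of_neighbor hnet hL hξ hμ₀ hy hN hδ hδ1 hmin hq1 hxz.1 hxz.2.1 hxz.2.2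
      hne h ih
  · exact hbase hxz.1 h

/-- The agents of a sending sub-network learn their true state, and every moment of order above one
of the missing mass is summable over time. -/
lemma summable_integral_residual_sending (hnet : IsWeakNetwork net a)
    (hL : ∀ k θ, IsPmf fun ζ : Z k => L k ζ θ)
    (hξ : IsSignalProcess P L (trueState net θS θR) ξ) (hμ₀ : ∀ k, IsPmf (μ₀ k))
    (hprior : ∃ k, net k = Sum.inl s ∧ 0 < μ₀ k (θS s))
    (hprevailing : ∀ k, net k = Sum.inl s → ∃ ζ : Z k, IsPrevailing L (θS s) k ζ)
    (hident : ⋂ k ∈ {k | net k = Sum.inl s}, indistinguishable L (θS s) k = {θS s})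
    {δ : ℝ} (hδ : 0 < δ) (hδ1 : δ ≤ 1)
    (hmin : ∀ k ζ, 0 < L k ζ (trueState net θS θR k) → δ ≤ L k ζ (trueState net θS θR k))
    {q : ℝ} (hq : 0 < q) (hq1 : q ≤ 1) {k : V} (hk : net k = Sum.inl s) :
    Summable fun i => ∫ ω, residual {θS s} (randomBelief a L μ₀ ξ i ω k) ^ (1 + q) ∂P := by
  classical
  obtain ⟨y, hy⟩ := hnet.exists_isPerronWeight s
  obtain ⟨N, hN⟩ := exists_belief_pos (θR := θR) hnet hL hμ₀ hprior
  rw [← summable_nat_add_iff N]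
  simp only [add_comm _ N]
  set I := Finset.univ.filter fun j => net j = Sum.inl s with hI
  set T := Finset.univ.erase (θS s) with hT
  set C := ((2 * ∑ k, y k) ^ (1 - q) + 2) * (Fintype.card V * Fintype.card Θ : ℝ) ^ 2 with hC
  set g : ℝ → V → Θ → (V → Θ → ℝ) → ℝ := fun q j θ μ =>
    potential y (θS s) μ ^ (q - 1) * μ j θ ^ 2 with hg
  have hgsum : ∀ q : ℝ, 0 < q → q ≤ 1 → ∀ j ∈ I, ∀ θ ∈ T,
      Summable fun i => ∫ ω, g q j θ (randomBelief a L μ₀ ξ (N + i) ω) ∂P :=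
    fun q hq hq1 j hj θ hθ => summable_integral_of_ne hnet hL hξ hμ₀ hy hN hδ hδ1 hmin hprevailing
      hident hq hq1 (by simpa [hI] using hj) (Finset.ne_of_mem_erase hθ)
  have hgint : ∀ q j θ i, Integrable (fun ω => g q j θ (randomBelief a L μ₀ ξ (N + i) ω)) P :=
    fun q j θ i => hξ.integrable_belief (N + i) (g q j θ)
  have hsum : Summable fun i =>
      C * ∑ j ∈ I, ∑ θ ∈ T, (∫ ω, g q j θ (randomBelief a L μ₀ ξ (N + i) ω) ∂P +
        ∫ ω, g 1 j θ (randomBelief a L μ₀ ξ (N + i) ω) ∂P) :=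
    (summable_sum fun j hj => summable_sum fun θ hθ =>
      (hgsum q hq hq1 j hj θ hθ).add (hgsum 1 one_pos le_rfl j hj θ hθ)).mul_left C
  refine Summable.of_nonneg_of_le (fun i => integral_nonneg fun ω => ?_) (fun i => ?_) hsum
  · exact Real.rpow_nonneg (residual_nonneg (isSubPmf_belief hnet hL hμ₀ _ _ k) _) _
  · have hle : ∀ᵐ ω ∂P, residual {θS s} (randomBelief a L μ₀ ξ (N + i) ω k) ^ (1 + q) ≤
        C * ∑ j ∈ I, ∑ θ ∈ T, (g q j θ (randomBelief a L μ₀ ξ (N + i) ω) +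
          g 1 j θ (randomBelief a L μ₀ ξ (N + i) ω)) := by
      filter_upwards [hξ.ae_isAdmissible hL] with ω hω
      set μ := randomBelief a L μ₀ ξ (N + i) ω with hμ
      have hsub : ∀ k, IsSubPmf (μ k) := isSubPmf_belief hnet hL hμ₀ (fun j => ξ j ω) (N + i)
      have hpos := fun k hk => (hN _ hω (N + i) (by omega) k hk).1
      have hpmf := fun k hk => (hN _ hω (N + i) (by omega) k hk).2
      refine (hy.rpow_residual_le hpmf hsub hpos hq hq1 hk (M := ∑ j ∈ I, ∑ θ ∈ T, μ j θ ^ 2)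
        (by positivity) fun j hj θ hθ => ?_).trans_eq ?_
      · have h1 : μ j θ ^ 2 ≤ ∑ θ ∈ T, μ j θ ^ 2 :=
          Finset.single_le_sum (f := fun θ => μ j θ ^ 2) (fun _ _ => sq_nonneg _)
            (by simp [hT, hθ])
        exact h1.trans (Finset.single_le_sum (f := fun j => ∑ θ ∈ T, μ j θ ^ 2)
          (fun _ _ => by positivity) (by simp [hI, hj]))
      · change C * _ = _
        congr 1
        simp only [hg, Finset.sum_add_distrib, Finset.mul_sum, sub_self, Real.rpow_zero, one_mul]
        rfl
    refine (integral_mono_ae (hξ.integrable_belief (N + i)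
      fun μ => residual {θS s} (μ k) ^ (1 + q)) (hξ.integrable_belief (N + i)
      fun μ => C * ∑ j ∈ I, ∑ θ ∈ T, (g q j θ μ + g 1 j θ μ)) hle).trans_eq ?_
    have hadd : ∀ j θ, Integrable (fun ω => g q j θ (randomBelief a L μ₀ ξ (N + i) ω) +
        g 1 j θ (randomBelief a L μ₀ ξ (N + i) ω)) P := fun j θ =>
      (hgint q j θ i).add (hgint 1 j θ i)
    rw [integral_const_mul, integral_finsetSum]
    · congr 1
      refine Finset.sum_congr rfl fun j _ => ?_
      rw [integral_finsetSum _ fun θ _ => hadd j θ]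
      exact Finset.sum_congr rfl fun θ _ => integral_add (hgint q j θ i) (hgint 1 j θ i)
    · exact fun j _ => integrable_finsetSum _ fun θ _ => hadd j θ

end Sending

/-! ### Receiving sub-networks -/

open scoped Classical in
/-- The states on which agent `k` concentrates its belief: its true state for a sending agent, and
the true states of all sending sub-networks for a receiving agent. -/
def limitStates {V Θ : Type*} {S R : ℕ} (net : V → Fin S ⊕ Fin R) (θS : Fin S → Θ) (k : V) :
    Finset Θ :=
  Sum.elim (fun s => {θS s}) (fun _ => Finset.univ.image θS) (net k)

section Receiving

variable {V Θ Ω : Type*} {Z : V → Type*} [Fintype V] [Fintype Θ] [∀ k, Fintype (Z k)]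
  [∀ k, MeasurableSpace (Z k)] [∀ k, DiscreteMeasurableSpace (Z k)]
  [MeasurableSpace Ω] {P : Measure Ω} [IsProbabilityMeasure P]
  {S R : ℕ} {net : V → Fin S ⊕ Fin R} {a : Matrix V V ℝ}
  {L : ∀ k, Z k → Θ → ℝ} {θS : Fin S → Θ} {θR : Fin R → Θ}
  {ξ : ℕ → Ω → ∀ k, Z k} {μ₀ : V → Θ → ℝ}

omit [Fintype V] [Fintype Θ] in
lemma limitStates_inl {k : V} {s : Fin S} (hk : net k = Sum.inl s) :
    limitStates net θS k = {θS s} := by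
  simp [limitStates, hk]

omit [Fintype V] [Fintype Θ] in
lemma limitStates_subset {k : V} {r : Fin R} (hk : net k = Sum.inr r) (ℓ : V) :
    limitStates net θS ℓ ⊆ limitStates net θS k := by
  rcases h : net ℓ with s | r' <;> simp [limitStates, hk, h]

omit [Fintype V] [Fintype Θ] [∀ k, Fintype (Z k)] [∀ k, MeasurableSpace (Z k)]
  [∀ k, DiscreteMeasurableSpace (Z k)] in
lemma eq_of_mem_limitStates
    (hindist : ∀ r k, net k = Sum.inr r → ∀ s, θS s ∈ indistinguishable L (θR r) k) (k : V) :
    ∀ θ ∈ limitStates net θS k, ∀ ζ, L k ζ θ = L k ζ (trueState net θS θR k) := by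
  intro θ hθ ζ
  rcases h : net k with s | r
  · rw [limitStates_inl h, Finset.mem_singleton] at hθ
    rw [trueState_inl h, hθ]
  · simp only [limitStates, h, Sum.elim_inr, Finset.mem_image, Finset.mem_univ, true_and] at hθ
    obtain ⟨s, rfl⟩ := hθ
    rw [trueState_inr h]
    exact hindist r k h s ζ

omit [∀ k, MeasurableSpace (Z k)] [∀ k, DiscreteMeasurableSpace (Z k)] in
lemma residual_diffuse_le (hnet : IsWeakNetwork net a) (hL : ∀ k θ, IsPmf fun ζ : Z k => L k ζ θ)
    {μ : V → Θ → ℝ} (hμ : ∀ k, IsSubPmf (μ k)) (z : ∀ k, Z k) {T : V → Finset Θ} {k : V}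
    (hT : ∀ ℓ, T ℓ ⊆ T k) :
    residual (T k) (diffuse a L μ z k) ≤
      ∑ ℓ, a ℓ k * residual (T ℓ) (posterior (L ℓ) (μ ℓ) (z ℓ)) := by
  have e : residual (T k) (diffuse a L μ z k) =
      ∑ ℓ, a ℓ k * residual (T k) (posterior (L ℓ) (μ ℓ) (z ℓ)) := by
    simp only [residual, diffuse, mul_sub, mul_one, Finset.sum_sub_distrib, hnet.sum_eq_one]
    rw [Finset.sum_comm]
    simp only [Finset.mul_sum]
  rw [e]
  refine Finset.sum_le_sum fun ℓ _ => mul_le_mul_of_nonneg_left ?_ (hnet.nonneg ℓ k)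
  have := Finset.sum_le_sum_of_subset_of_nonneg (hT ℓ)
    (fun θ _ _ => (isSubPmf_posterior (hL ℓ) (hμ ℓ) (z ℓ)).1 θ)
  unfold residual
  linarith

lemma integral_rpow_residual_le (hnet : IsWeakNetwork net a)
    (hL : ∀ k θ, IsPmf fun ζ : Z k => L k ζ θ) {θ₀ : V → Θ}
    (hξ : IsSignalProcess P L θ₀ ξ) (hμ₀ : ∀ k, IsPmf (μ₀ k))
    {δ : ℝ} (hδ : 0 < δ) (hδ1 : δ ≤ 1) (hmin : ∀ k ζ, 0 < L k ζ (θ₀ k) → δ ≤ L k ζ (θ₀ k))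
    {T : V → Finset Θ} (hTL : ∀ k, ∀ θ ∈ T k, ∀ ζ, L k ζ θ = L k ζ (θ₀ k))
    {q : ℝ} (hq : 0 < q) {k : V} (hT : ∀ ℓ, T ℓ ⊆ T k) (i : ℕ) :
    ∫ ω, residual (T k) (randomBelief a L μ₀ ξ (i + 1) ω k) ^ (1 + q) ∂P ≤
      (2 / δ) ^ q * ∑ ℓ, a ℓ k * ∫ ω, residual (T ℓ) (randomBelief a L μ₀ ξ i ω ℓ) ^ (1 + q) ∂P := by
  set f : ∀ ℓ, (V → Θ → ℝ) → Z ℓ → ℝ := fun ℓ μ z =>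
    residual (T ℓ) (posterior (L ℓ) (μ ℓ) z) ^ (1 + q) with hf
  have hsub := fun ω => isSubPmf_belief hnet hL hμ₀ (fun j => ξ j ω)
  have hfint : ∀ ℓ, Integrable
      (fun ω => a ℓ k * f ℓ (randomBelief a L μ₀ ξ i ω) (ξ (i + 1) ω ℓ)) P := fun ℓ =>
    (hξ.integrable_belief_signal i ℓ (f ℓ)).const_mul (a ℓ k)
  have hstep : ∀ ω, residual (T k) (randomBelief a L μ₀ ξ (i + 1) ω k) ^ (1 + q) ≤
      ∑ ℓ, a ℓ k * f ℓ (randomBelief a L μ₀ ξ i ω) (ξ (i + 1) ω ℓ) := by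
    intro ω
    have h1 := residual_diffuse_le hnet hL (hsub ω i) (ξ (i + 1) ω) hT
    have h2 := residual_nonneg (hsub ω (i + 1) k) (T k)
    refine (Real.rpow_le_rpow h2 h1 (by linarith)).trans ?_
    exact Real.rpow_arith_mean_le_arith_mean_rpow _ _ _ (fun ℓ _ => hnet.nonneg ℓ k)
      (hnet.sum_eq_one k)
      (fun ℓ _ => residual_nonneg (isSubPmf_posterior (hL ℓ) (hsub ω i ℓ) _) _) (by linarith)
  refine (integral_mono (hξ.integrable_belief (i + 1) fun μ => residual (T k) (μ k) ^ (1 + q))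
    (integrable_finsetSum _ fun ℓ _ => hfint ℓ) hstep).trans ?_
  rw [integral_finsetSum _ fun ℓ _ => hfint ℓ, Finset.mul_sum]
  refine Finset.sum_le_sum fun ℓ _ => ?_
  rw [integral_const_mul, mul_left_comm]
  refine mul_le_mul_of_nonneg_left ?_ (hnet.nonneg ℓ k)
  rw [hξ.integral_belief_signal i ℓ (f ℓ), ← integral_const_mul]
  refine integral_mono
    (hξ.integrable_belief i fun μ => ∑ ζ, L ℓ ζ (θ₀ ℓ) * f ℓ μ ζ)
    (hξ.integrable_belief i fun μ => (2 / δ) ^ q * residual (T ℓ) (μ ℓ) ^ (1 + q)) fun ω => ?_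
  exact sum_mul_rpow_residual_posterior_le (hL ℓ) (hsub ω i ℓ) (hTL ℓ) (hL ℓ (θ₀ ℓ)) hδ hδ1
    (hmin ℓ) hq

lemma exists_rpow_mul_lt_one {K ρ : ℝ} (hK : 0 < K) (hρ : ρ < 1) :
    ∃ q : ℝ, 0 < q ∧ q ≤ 1 ∧ K ^ q * ρ < 1 := by
  have h1 : Tendsto (fun q : ℝ => K ^ q * ρ) (𝓝[>] 0) (𝓝 (K ^ (0 : ℝ) * ρ)) :=
    (((Real.continuous_const_rpow hK.ne').mul continuous_const).tendsto 0).mono_left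
      nhdsWithin_le_nhds
  rw [Real.rpow_zero, one_mul] at h1
  obtain ⟨q, hq, hq'⟩ := ((h1.eventually_lt_const hρ).and (Ioc_mem_nhdsGT one_pos)).exists
  exact ⟨q, hq'.1, hq'.2, hq⟩

omit [Fintype V] [∀ k, MeasurableSpace (Z k)] [∀ k, DiscreteMeasurableSpace (Z k)] in
/-- Forecasts are correct in the limit if the belief concentrates on states with the true law. -/
lemma tendsto_predictive {k : V} (hL : ∀ θ, IsPmf fun ζ : Z k => L k ζ θ) {p : ℕ → Θ → ℝ}
    (hp : ∀ i, IsSubPmf (p i)) {T : Finset Θ} {θ₀ : Θ} (hT : ∀ θ ∈ T, ∀ ζ, L k ζ θ = L k ζ θ₀)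
    (h : Tendsto (fun i => residual T (p i)) atTop (𝓝 0)) (ζ : Z k) :
    Tendsto (fun i => predictive (L k) (p i) ζ) atTop (𝓝 (L k ζ θ₀)) := by
  have e : ∀ i, ∑ θ ∈ T, p i θ * L k ζ θ = (1 - residual T (p i)) * L k ζ θ₀ := by
    intro i
    rw [residual, sub_sub_cancel, Finset.sum_mul]
    exact Finset.sum_congr rfl fun θ hθ => by rw [hT θ hθ]
  have h1 : Tendsto (fun i => (1 - residual T (p i)) * L k ζ θ₀) atTop (𝓝 (L k ζ θ₀)) := by
    simpa using (h.const_sub 1).mul_const (L k ζ θ₀)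
  have h2 : Tendsto (fun i => (1 - residual T (p i)) * L k ζ θ₀ + residual T (p i)) atTop
      (𝓝 (L k ζ θ₀)) := by
    simpa using h1.add h
  refine tendsto_of_tendsto_of_tendsto_of_le_of_le h1 h2 (fun i => ?_) fun i => ?_
  · have := le_predictive hL (hp i) T ζ
    rwa [e] at this
  · have := predictive_le hL (hp i) T ζ
    rwa [e] at this

end Receiving

end

end SocialLearning

open SocialLearning
theorem lemma4 {V Θ Ω : Type*} {Z : V → Type*} [Fintype V] [Fintype Θ] [∀ k, Fintype (Z k)]
    [∀ k, MeasurableSpace (Z k)] [∀ k, DiscreteMeasurableSpace (Z k)]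
    [MeasurableSpace Ω] (P : Measure Ω) [IsProbabilityMeasure P]
    {S R : ℕ} (net : V → Fin S ⊕ Fin R) (a : Matrix V V ℝ) (hnet : IsWeakNetwork net a)
    (L : ∀ k, Z k → Θ → ℝ) (hL : ∀ k θ, IsPmf (fun ζ : Z k => L k ζ θ))
    (θS : Fin S → Θ) (θR : Fin R → Θ)
    (ξ : ℕ → Ω → ∀ k, Z k) (hξ : IsSignalProcess P L (trueState net θS θR) ξ)
    (μ₀ : V → Θ → ℝ) (hμ₀ : ∀ k, IsPmf (μ₀ k))
    -- the conditions under which the sending sub-networks learn their own true states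
    (hprior : ∀ s, ∃ k, net k = Sum.inl s ∧ 0 < μ₀ k (θS s))
    (hprevailing : ∀ s k, net k = Sum.inl s → ∃ ζ : Z k, IsPrevailing L (θS s) k ζ)
    (hident : ∀ s, ⋂ k ∈ {k | net k = Sum.inl s}, indistinguishable L (θS s) k = {θS s})
    -- receiving agents cannot tell the true states of the sending sub-networks from their own
    (hindist : ∀ r k, net k = Sum.inr r → ∀ s, θS s ∈ indistinguishable L (θR r) k) :
    ∀ r k, net k = Sum.inr r → ∀ ζ : Z k, ∀ᵐ ω ∂P,
      Tendsto (fun i => forecast a L μ₀ (fun j => ξ j ω) i k ζ) atTop (𝓝 (L k ζ (θR r))) := by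
  intro r k hk ζ
  obtain ⟨δ, hδ, hδ1, hmin⟩ :=
    exists_pos_le fun x : Σ k, Z k => L x.1 x.2 (trueState net θS θR x.1)
  replace hmin : ∀ k ζ, 0 < L k ζ (trueState net θS θR k) → δ ≤ L k ζ (trueState net θS θR k) :=
    fun k ζ => hmin ⟨k, ζ⟩
  obtain ⟨u, ρ, hρ, -, huS, huR, hu⟩ := hnet.exists_contraction
  obtain ⟨q, hq, hq1, hqρ⟩ := exists_rpow_mul_lt_one (K := 2 / δ) (by positivity) hρ
  have hres : ∀ k i ω, 0 ≤ residual (limitStates net θS k) (randomBelief a L μ₀ ξ i ω k) :=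
    fun k i ω => residual_nonneg (isSubPmf_belief hnet hL hμ₀ _ i k) _
  have hsum := summable_of_contraction hnet huS huR hu (κ := (2 / δ) ^ q) (by positivity) hqρ
    (c := fun k i =>
      ∫ ω, residual (limitStates net θS k) (randomBelief a L μ₀ ξ i ω k) ^ (1 + q) ∂P)
    (fun k i => integral_nonneg fun ω => Real.rpow_nonneg (hres k i ω) _)
    (fun k s hk => by
      simp only [limitStates_inl hk]
      exact summable_integral_residual_sending hnet hL hξ hμ₀ (hprior s) (hprevailing s) (hident s)
        hδ hδ1 hmin hq hq1 hk)
    (fun k r hk i => integral_rpow_residual_le hnet hL hξ hμ₀ hδ hδ1 hmin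
      (eq_of_mem_limitStates hindist) hq (limitStates_subset hk) i) k
  have hlim := ae_tendsto_zero_of_summable_integral
    (fun i => hξ.integrable_belief i fun μ => residual (limitStates net θS k) (μ k) ^ (1 + q))
    (fun i => ae_of_all _ fun ω => Real.rpow_nonneg (hres k i ω) _) hsum
  filter_upwards [hlim] with ω hω
  have hroot : Tendsto
      (fun i => residual (limitStates net θS k) (randomBelief a L μ₀ ξ i ω k)) atTop (𝓝 0) := by
    have h := hω.rpow_const (p := (1 + q)⁻¹) (Or.inr (by positivity))
    rw [Real.zero_rpow (by positivity)] at h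
    refine h.congr fun i => ?_
    rw [← Real.rpow_mul (hres k i ω), mul_inv_cancel₀ (by positivity), Real.rpow_one]
  have hT := eq_of_mem_limitStates (net := net) hindist k
  rw [trueState_inr hk] at hT
  exact tendsto_predictive (hL k) (fun i => isSubPmf_belief hnet hL hμ₀ _ i k) hT hroot ζ
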